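/- For integers $U\ge m\ge 1$, let $S=\{s_1<\dots<s_m\}\subseteq\{1,\dots,U\}$ be a random set of $m$ points with the Catalan-weighted distribution \[ \Pr[S=\{s_1,\dots,s_m\}]=\frac{1}{M(U,m)}\prod_{j=0}^{m}C_{s_{j+1}-s_j-1},\qquad s_0:=0,\quad s_{m+1}:=U+1, \] where $C_n$ is the $n$-th Catalan number and $M(U,m)$ is the sum of $\prod_{j=0}^{m}C_{s_{j+1}-s_j-1}$ over all $0=s_0<s_1<\dots<s_m<s_{m+1}=U+1$. Let $k=(\log_2 B)^4$, $L=\lfloor m^2/k\rfloor$ and, if $L\ge 1$, $K=\lfloor U/L\rfloor$. Let $\Delta$ be uniform on $\{1,\dots,L\}$ and independent of $S$, and for $1\le j\le K$ let $E_j$ be the indicator of the event that the interval $[\Delta+jL,\Delta+(j+1)L)$ contains at least one point of $S$. Then for all constants $0<a\le b$ there are a constant $c>0$ and an integer $B_0$, depending only on $a$ and $b$, such that for all integers $B\ge B_0$ and all $m,U$ with $L\ge 1$ and $am^2\le U\le bm^2$ (that is, $U=\Theta(m^2)$, as for a good block), the Shannon entropy (in bits) of the random vector $(E_1,\dots,E_K)$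 satisfies \[ H(E_1,\dots,E_K)\ \ge\ c\sqrt{k}. \] -/

import Mathlib

open Finset

/-- Configurations `0 = s 0 < s 1 < ⋯ < s m < s (m + 1) = U + 1` of `m` points in a block
`{1, …, U}`, with the two sentinels included. -/
def blockConfigs (U m : ℕ) : Finset (Fin (m + 2) → ℕ) :=
  (Fintype.piFinset fun _ => range (U + 2)).filter fun s =>
    s 0 = 0 ∧ s (Fin.last (m + 1)) = U + 1 ∧ ∀ j : Fin (m + 1), s j.castSucc < s j.succ

/-- The Catalan weight `∏_{j=0}^{m} C_{s_{j+1} - s_j - 1}` of a configuration. -/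
def catalanWeight {m : ℕ} (s : Fin (m + 2) → ℕ) : ℕ :=
  ∏ j : Fin (m + 1), catalan (s j.succ - s j.castSucc - 1)

/-- The normalizing constant `M(U, m)`. -/
def catalanTotal (U m : ℕ) : ℕ :=
  ∑ s ∈ blockConfigs U m, catalanWeight s

/-- The sample space of pairs `(s, Δ)` with `Δ ∈ {1, …, L}`. -/
def blockSpace (U m L : ℕ) : Finset ((Fin (m + 2) → ℕ) × ℕ) :=
  blockConfigs U m ×ˢ Icc 1 L

/-- The joint law of `(s, Δ)`: `s` is Catalan-weighted, and `Δ` is independent of `s` and uniform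
on `{1, …, L}`. -/
noncomputable def blockProb (U m L : ℕ) (ω : (Fin (m + 2) → ℕ) × ℕ) : ℝ :=
  ((catalanWeight ω.1 : ℝ) / (catalanTotal U m : ℝ)) * (1 / (L : ℝ))

/-- The indicator `E_j` that the interval `[Δ + j L, Δ + (j + 1) L)` contains one of the points
`s 1, …, s m` (the sentinels `s 0` and `s (m + 1)` are not points). -/
def intervalNonempty {m : ℕ} (L : ℕ) (ω : (Fin (m + 2) → ℕ) × ℕ) (j : ℕ) : Bool :=
  decide (∃ i : Fin m, ω.2 + j * L ≤ ω.1 i.castSucc.succ ∧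
    ω.1 i.castSucc.succ < ω.2 + (j + 1) * L)

/-- Shannon entropy, in bits, of a random variable `X` on a finite probability space with
point masses `P`. -/
noncomputable def shannonEntropy {Ω α : Type*} [Fintype α] [DecidableEq α]
    (space : Finset Ω) (P : Ω → ℝ) (X : Ω → α) : ℝ :=
  ∑ x : α, Real.negMulLog (∑ ω ∈ space with X ω = x, P ω) / Real.log 2

/-- The entropy of the random vector `(E_1, …, E_K)`, where `K = ⌊U / L⌋`. -/
noncomputable def indicatorEntropy (U m L : ℕ) : ℝ :=
  shannonEntropy (blockSpace U m L) (blockProb U m L)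
    (fun ω (j : ↥(Icc 1 (U / L))) => intervalNonempty L ω j)

/-- `k = log⁴ B`. -/
noncomputable def logFourth (B : ℕ) : ℝ := Real.logb 2 (B : ℝ) ^ 4

/-- `L = ⌊m² / k⌋`. -/
noncomputable def intervalLength (B m : ℕ) : ℕ := ⌊(m : ℝ) ^ 2 / logFourth B⌋₊

/-! Up to a constant factor, the Catalan weight of a configuration is the probability that `m + 1`
independent first-passage gaps take the prescribed values. So `S` is the set of partial sums of
i.i.d. gaps conditioned on total `U + 1`, and the gap vector is exchangeable.

The entropy comes from this symmetry. Cut the gaps into `n`, of order `√k`, consecutive blocks of `2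
* t` gaps with `t` about `√L / 4`, and let a bit vector `τ` decide which blocks exchange their
halves. This preserves the law and every block's starting position. If one half jumps over a whole
window that the other half hits, the corresponding `E_j` reveals the bit
(`intervalNonempty_swapPerm`). With `ν` visible blocks, each value of the vector arises from at most
a fraction `2 ^ (-ν)` of all `τ`. By concavity the entropy is at least the mean of `ν`
(`sum_mul_le_shannonEntropy`).

It remains to see that each block is visible with probability bounded below. A gap has a length in a
given range of order `L` with probability of order `L ^ (-1/2)`, there are about `√L` places for it
in each half, and the remaining gaps of the half are short with probability at least 1/2
(`le_sum_goodBlock`). Conditioning on the total costs only a constant factor, since the densities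
with and without the block are both of order `m ^ (-2)` (`exists_le_passageProb`, `passageProb_le`).
A random shift aligns a window at least half of the time. -/

/-! ### The gap law and its generating series. -/

/-- The generating series `∑_{s ≥ 1} 2 C_{s-1} 4^{-s} X^s` of the first passage time of the simple
random walk, with times halved. -/
noncomputable def passageSeries : PowerSeries ℝ :=
  PowerSeries.rescale (1 / 4 : ℝ)
    (2 * (PowerSeries.X * PowerSeries.map (Nat.castRingHom ℝ) PowerSeries.catalanSeries))

/-- The probability that `n` independent gaps have sum `s`. -/
noncomputable def passageProb (n s : ℕ) : ℝ := PowerSeries.coeff s (passageSeries ^ n)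

lemma coeff_passageSeries_zero : PowerSeries.coeff 0 passageSeries = 0 := by
  simp [passageSeries, mul_left_comm (2 : PowerSeries ℝ)]

lemma coeff_passageSeries_succ (s : ℕ) :
    PowerSeries.coeff (s + 1) passageSeries = 2 * (catalan s : ℝ) / 4 ^ (s + 1) := by
  rw [passageSeries, PowerSeries.coeff_rescale, mul_left_comm, PowerSeries.coeff_succ_X_mul,
    show (2 : PowerSeries ℝ) = PowerSeries.C 2 from (map_ofNat _ 2).symm, PowerSeries.coeff_C_mul,
    PowerSeries.coeff_map, PowerSeries.catalanSeries_coeff]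
  simp [div_eq_mul_inv]
  ring

lemma coeff_passageSeries_nonneg (s : ℕ) : 0 ≤ PowerSeries.coeff s passageSeries := by
  cases s with
  | zero => rw [coeff_passageSeries_zero]
  | succ s => rw [coeff_passageSeries_succ]; positivity

/-- The series is `1 - √(1 - X)`, so this is `(1 - f) ^ 2 = 1 - X`. It gives the three-term
recursion in `n` behind both the convexity of the distribution function and the ballot formula. -/
lemma passageSeries_sq : passageSeries ^ 2 = 2 * passageSeries - PowerSeries.X := by
  have h := congrArg (fun p => PowerSeries.rescale (1 / 4 : ℝ)
    (PowerSeries.map (Nat.castRingHom ℝ) p)) PowerSeries.catalanSeries_sq_mul_X_add_one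
  simp only [map_add, map_mul, map_pow, map_one, PowerSeries.map_X] at h
  have hX : PowerSeries.rescale (1 / 4 : ℝ) PowerSeries.X
      = PowerSeries.C (1 / 4 : ℝ) * PowerSeries.X := PowerSeries.rescale_X _
  have h4 : (4 : PowerSeries ℝ) * PowerSeries.C (1 / 4 : ℝ) = 1 := by
    rw [show (4 : PowerSeries ℝ) = PowerSeries.C 4 from (map_ofNat _ 4).symm, ← map_mul]
    norm_num
  simp only [passageSeries, map_mul, map_ofNat]
  rw [hX] at h ⊢
  set c := PowerSeries.rescale (1 / 4 : ℝ)
    (PowerSeries.map (Nat.castRingHom ℝ) PowerSeries.catalanSeries)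
  linear_combination (4 * PowerSeries.C (1 / 4 : ℝ) * PowerSeries.X) * h -
    PowerSeries.X * h4

lemma passageProb_nonneg (n s : ℕ) : 0 ≤ passageProb n s := by
  unfold passageProb
  rw [PowerSeries.coeff_pow]
  exact sum_nonneg fun l _ => prod_nonneg fun i _ => coeff_passageSeries_nonneg _

lemma passageProb_zero (s : ℕ) : passageProb 0 s = if s = 0 then 1 else 0 := by
  simp [passageProb, PowerSeries.coeff_one]

lemma passageProb_one (s : ℕ) : passageProb 1 s = PowerSeries.coeff s passageSeries := by
  simp [passageProb]

lemma passageProb_add_two_zero (n : ℕ) :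
    passageProb (n + 2) 0 = 2 * passageProb (n + 1) 0 := by
  have : PowerSeries.constantCoeff passageSeries = 0 := by
    simpa using coeff_passageSeries_zero
  simp [passageProb, pow_succ, this]

lemma passageProb_add_two_succ (n s : ℕ) :
    passageProb (n + 2) (s + 1) = 2 * passageProb (n + 1) (s + 1) - passageProb n s := by
  have : passageSeries ^ (n + 2)
      = PowerSeries.C 2 * passageSeries ^ (n + 1) - PowerSeries.X * passageSeries ^ n := by
    rw [pow_add, passageSeries_sq]
    simp only [map_ofNat]
    ring
  unfold passageProb
  rw [this, map_sub, PowerSeries.coeff_C_mul, PowerSeries.coeff_succ_X_mul]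

/-! ### Central binomial bounds and sums of few gaps. -/

/-- The factor `2 * n + 1` makes the induction step reduce to `(2n + 1)(2n + 3) ≤ 4 (n + 1) ^ 2`. -/
lemma sq_centralBinom_mul_le (n : ℕ) : n.centralBinom ^ 2 * (2 * n + 1) ≤ 16 ^ n := by
  induction n with
  | zero => simp
  | succ n ih =>
    have h := Nat.succ_mul_centralBinom_succ n
    have : (n + 1) ^ 2 * ((n + 1).centralBinom ^ 2 * (2 * (n + 1) + 1))
        ≤ (n + 1) ^ 2 * 16 ^ (n + 1) := by
      calc (n + 1) ^ 2 * ((n + 1).centralBinom ^ 2 * (2 * (n + 1) + 1))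
          = ((n + 1) * (n + 1).centralBinom) ^ 2 * (2 * n + 3) := by ring
        _ = (n.centralBinom ^ 2 * (2 * n + 1)) * (4 * (2 * n + 1) * (2 * n + 3)) := by
          rw [h]; ring
        _ ≤ 16 ^ n * (4 * (2 * n + 1) * (2 * n + 3)) := by gcongr
        _ ≤ 16 ^ n * (16 * (n + 1) ^ 2) := by gcongr 16 ^ n * ?_; nlinarith
        _ = _ := by ring
    exact Nat.le_of_mul_le_mul_left this (by positivity)

lemma le_sq_centralBinom_mul (n : ℕ) : 16 ^ n ≤ n.centralBinom ^ 2 * (4 * n + 1) := by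
  induction n with
  | zero => simp
  | succ n ih =>
    have h := Nat.succ_mul_centralBinom_succ n
    have : (n + 1) ^ 2 * 16 ^ (n + 1)
        ≤ (n + 1) ^ 2 * ((n + 1).centralBinom ^ 2 * (4 * (n + 1) + 1)) := by
      calc (n + 1) ^ 2 * 16 ^ (n + 1) = 16 ^ n * (16 * (n + 1) ^ 2) := by ring
        _ ≤ (n.centralBinom ^ 2 * (4 * n + 1)) * (16 * (n + 1) ^ 2) := by gcongr
        _ = n.centralBinom ^ 2 * ((4 * n + 1) * (16 * (n + 1) ^ 2)) := by ring
        _ ≤ n.centralBinom ^ 2 * (4 * (2 * n + 1) ^ 2 * (4 * n + 5)) := by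
          gcongr n.centralBinom ^ 2 * ?_; nlinarith
        _ = (2 * (2 * n + 1) * n.centralBinom) ^ 2 * (4 * n + 5) := by ring
        _ = _ := by rw [← h]; ring
    exact Nat.le_of_mul_le_mul_left this (by positivity)

lemma centralBinom_div_le (n : ℕ) :
    (n.centralBinom : ℝ) / 4 ^ n ≤ 1 / Real.sqrt (2 * n + 1) := by
  have h : (n.centralBinom : ℝ) ^ 2 * (2 * n + 1) ≤ 16 ^ n := by
    exact_mod_cast sq_centralBinom_mul_le n
  rw [div_le_div_iff₀ (by positivity) (by positivity), one_mul]
  apply (sq_le_sq₀ (by positivity) (by positivity)).1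
  rw [mul_pow, Real.sq_sqrt (by positivity), ← pow_mul, mul_comm n 2, pow_mul]
  norm_num
  exact h

lemma le_centralBinom_div (n : ℕ) :
    1 / Real.sqrt (4 * n + 1) ≤ (n.centralBinom : ℝ) / 4 ^ n := by
  have h : (16 : ℝ) ^ n ≤ (n.centralBinom : ℝ) ^ 2 * (4 * n + 1) := by
    exact_mod_cast le_sq_centralBinom_mul n
  rw [div_le_div_iff₀ (by positivity) (by positivity), one_mul]
  apply (sq_le_sq₀ (by positivity) (by positivity)).1
  rw [mul_pow, Real.sq_sqrt (by positivity), ← pow_mul, mul_comm n 2, pow_mul]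
  norm_num
  exact h

lemma catalan_eq_real (n : ℕ) : (catalan n : ℝ) = n.centralBinom / (n + 1) := by
  rw [eq_div_iff (by positivity), mul_comm]
  exact_mod_cast succ_mul_catalan_eq_centralBinom n

/-- `P(gap ≥ 1 + x) = centralBinom x / 4 ^ x`. -/
lemma sum_passageProb_one (x : ℕ) :
    ∑ s ∈ range (x + 1), passageProb 1 s = 1 - (x.centralBinom : ℝ) / 4 ^ x := by
  induction x with
  | zero => simp [passageProb_one, coeff_passageSeries_zero]
  | succ x ih =>
    have h : ((x : ℝ) + 1) * (x + 1).centralBinom = 2 * (2 * x + 1) * x.centralBinom := by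
      exact_mod_cast Nat.succ_mul_centralBinom_succ x
    have h' : ((x + 1).centralBinom : ℝ) = 2 * (2 * x + 1) * x.centralBinom / (x + 1) := by
      rw [eq_div_iff (by positivity), ← h, mul_comm]
    rw [sum_range_succ, ih, passageProb_one, coeff_passageSeries_succ, catalan_eq_real, h']
    field_simp
    ring

/-- The distribution function of the sum of `n` gaps is convex in `n`. -/
lemma sum_passageProb_convex (n x : ℕ) :
    2 * ∑ s ∈ range (x + 1), passageProb (n + 1) s
      ≤ ∑ s ∈ range (x + 1), passageProb (n + 2) s + ∑ s ∈ range (x + 1), passageProb n s := by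
  -- By the recursion the second difference in `n` at `x` is the distribution function at `x` minus
  -- its value at `x - 1`, so monotonicity suffices.
  have h := sum_le_sum_of_subset_of_nonneg (range_mono (Nat.le_succ x))
    (fun s _ _ => passageProb_nonneg n s)
  rw [sum_range_succ' _ x, sum_range_succ' (fun s => passageProb (n + 2) s) x,
    passageProb_add_two_zero]
  simp only [passageProb_add_two_succ, sum_sub_distrib, ← mul_sum, Nat.succ_eq_add_one] at h ⊢
  linarith

/-- A union bound: by convexity every increment in `n` is at least the first, which is minus the
tail of one gap. -/
lemma le_sum_passageProb (n x : ℕ) :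
    1 - n / Real.sqrt (2 * x + 1) ≤ ∑ s ∈ range (x + 1), passageProb n s := by
  set H : ℕ → ℝ := fun n => ∑ s ∈ range (x + 1), passageProb n s with hH
  have h0 : H 0 = 1 := by simp [hH, passageProb_zero]
  have h1 : -(1 / Real.sqrt (2 * x + 1)) ≤ H 1 - H 0 := by
    have := sum_passageProb_one x
    have := centralBinom_div_le x
    simp only [hH] at h0 ⊢
    linarith
  have hd : ∀ n, -(1 / Real.sqrt (2 * x + 1)) ≤ H (n + 1) - H n := by
    intro n
    induction n with
    | zero => exact h1
    | succ n ih =>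
      have := sum_passageProb_convex n x
      simp only [hH] at ih ⊢
      linarith
  suffices 1 - n / Real.sqrt (2 * x + 1) ≤ H n from this
  induction n with
  | zero => simp [h0]
  | succ n ih =>
    have := hd n
    push_cast
    rw [add_div]
    linarith

lemma le_coeff_passageSeries (s : ℕ) (hs : 1 ≤ s) :
    1 / (s * Real.sqrt s) / 4 ≤ PowerSeries.coeff s passageSeries := by
  obtain ⟨n, rfl⟩ := Nat.exists_eq_add_of_le' hs
  have h := le_centralBinom_div n
  rw [coeff_passageSeries_succ, catalan_eq_real]
  have h2 : 1 / (2 * Real.sqrt ((n : ℝ) + 1)) ≤ 1 / Real.sqrt (4 * n + 1) := by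
    apply one_div_le_one_div_of_le (by positivity)
    rw [show (2 : ℝ) = Real.sqrt 4 by rw [show (4 : ℝ) = 2 ^ 2 by norm_num]; simp,
      ← Real.sqrt_mul (by norm_num)]
    apply Real.sqrt_le_sqrt
    linarith
  have h3 := h2.trans h
  push_cast
  calc 1 / (((n : ℝ) + 1) * Real.sqrt (n + 1)) / 4
      = 1 / (2 * Real.sqrt ((n : ℝ) + 1)) * (1 / (2 * (n + 1))) := by field_simp; norm_num
    _ ≤ (n.centralBinom : ℝ) / 4 ^ n * (1 / (2 * (n + 1))) := by gcongr
    _ = _ := by rw [pow_succ]; field_simp; norm_num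

/-! ### Ballot formula and local bounds at the scale `s ≍ m ^ 2`. -/

/-- The ballot formula. -/
lemma passageProb_add (n q : ℕ) :
    ((n : ℝ) + 2 * q) * passageProb n (n + q) * 2 ^ (n + 2 * q)
      = n * (n + 2 * q).choose q := by
  induction n using Nat.strong_induction_on generalizing q with
  | _ n ih =>
    match n with
    | 0 =>
      rcases q with _ | q <;> simp [passageProb_zero]
    | 1 =>
      have hc := succ_mul_catalan_eq_centralBinom q
      have h2 := Nat.add_one_mul_choose_eq (2 * q) q
      have h3 : (2 * q + 1).choose (q + 1) = (2 * q + 1).choose q :=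
        Nat.choose_symm_of_eq_add (by omega)
      rw [h3,
        ← Nat.centralBinom_eq_two_mul_choose, ← hc] at h2
      have h4 : (2 * q + 1) * catalan q = (2 * q + 1).choose q := by
        apply Nat.eq_of_mul_eq_mul_right (show 0 < q + 1 by omega)
        rw [← h2]; ring
      rw [passageProb_one, add_comm 1 q, coeff_passageSeries_succ, add_comm 1 (2 * q), ← h4,
        pow_succ (2 : ℝ) (2 * q), pow_mul, pow_succ]
      push_cast
      norm_num
      field_simp
      ring
    | n + 2 =>
      have e1 := ih (n + 1) (by omega) (q + 1)
      have e2 := ih n (by omega) (q + 1)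
      rw [show n + 2 + q = (n + 1 + q) + 1 by ring, passageProb_add_two_succ]
      rw [show n + 1 + (q + 1) = n + 1 + q + 1 by ring] at e1
      rw [show n + (q + 1) = n + 1 + q by ring] at e2
      rw [show n + 1 + 2 * (q + 1) = (n + 2 + 2 * q) + 1 by ring] at e1
      rw [show n + 2 * (q + 1) = n + 2 + 2 * q by ring] at e2
      set N := n + 2 + 2 * q with hN
      -- `c1` and `c2` express the binomials of both induction hypotheses through `N.choose q`.
      have c1 : ((q : ℝ) + 1) * (N + 1).choose (q + 1) = (N + 1) * N.choose q := by
        have := Nat.add_one_mul_choose_eq N q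
        rw [mul_comm]; exact_mod_cast this.symm
      have c2 : ((q : ℝ) + 1) * N.choose (q + 1) = (n + 2 + q) * N.choose q := by
        have := Nat.choose_succ_right_eq N q
        rw [show N - q = n + 2 + q by omega] at this
        rw [mul_comm, mul_comm (_ : ℝ) (N.choose q : ℝ)]; exact_mod_cast this
      have hNr : (N : ℝ) = n + 2 + 2 * q := by rw [hN]; push_cast; ring
      push_cast at e1 e2 ⊢
      rw [pow_succ] at e1
      have hq : ((q : ℝ) + 1) ≠ 0 := by positivity
      have hn1 : ((n : ℝ) + 3 + 2 * q) ≠ 0 := by positivity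
      apply mul_left_cancel₀ hq
      apply mul_left_cancel₀ hn1
      linear_combination ((q:ℝ)+1) * ((n:ℝ) + 2 + 2 * q) * e1 - ((q:ℝ)+1) * ((n:ℝ)+3+2*q) * e2
        + ((n:ℝ) + 2 + 2 * q) * (n+1) * c1 - ((n:ℝ)+3+2*q) * n * c2 + ((n:ℝ) + 2 + 2 * q) * (n+1) * N.choose q * hNr

/-- Moving outward from the centre, each ratio `(p - i) / (p + i + 1)` of neighbouring coefficients
with `i < j` is at least `1 - 2j/p`. -/
lemma le_choose_central (p j : ℕ) (hp : 0 < p) (hj : 2 * j ≤ p) (i : ℕ) (hi : i ≤ j) :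
    (1 - 2 * (j : ℝ) / p) ^ i * p.centralBinom ≤ (2 * p).choose (p - i) := by
  have hp' : (0 : ℝ) < p := by exact_mod_cast hp
  have hj' : 2 * (j : ℝ) ≤ p := by exact_mod_cast hj
  have h0 : 0 ≤ 1 - 2 * (j : ℝ) / p := by
    rw [sub_nonneg, div_le_one hp']; exact hj'
  induction i with
  | zero => simp [Nat.centralBinom_eq_two_mul_choose]
  | succ i ih =>
    have ih := ih (by omega)
    have hi' : (i : ℝ) + 1 ≤ j := by exact_mod_cast hi
    have hr := Nat.choose_succ_right_eq (2 * p) (p - (i + 1))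
    rw [show p - (i + 1) + 1 = p - i by omega, show 2 * p - (p - (i + 1)) = p + i + 1 by omega] at hr
    have hr' : ((2 * p).choose (p - i) : ℝ) * (p - i) = (2 * p).choose (p - (i + 1)) * (p + i + 1) := by
      rw [← Nat.cast_sub (by omega : i ≤ p)]; exact_mod_cast hr
    have h1 : (1 - 2 * (j : ℝ) / p) * (p + i + 1) ≤ p - i := by
      have : 2 * (j : ℝ) / p * (p + i + 1) ≥ 2 * j := by
        rw [div_mul_eq_mul_div, ge_iff_le, le_div_iff₀ hp']
        have : (0 : ℝ) ≤ j * (i + 1) := by positivity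
        nlinarith
      linarith
    have hpi : (0 : ℝ) < p + i + 1 := by positivity
    refine le_of_mul_le_mul_right ?_ hpi
    rw [← hr']
    calc (1 - 2 * (j : ℝ) / p) ^ (i + 1) * p.centralBinom * (p + i + 1)
        = ((1 - 2 * (j : ℝ) / p) ^ i * p.centralBinom) * ((1 - 2 * (j : ℝ) / p) * (p + i + 1)) := by
          ring
      _ ≤ ((1 - 2 * (j : ℝ) / p) ^ i * p.centralBinom) * (p - i) := by gcongr
      _ ≤ _ := by
          gcongr
          linarith

/-- It suffices that `(1 - x)(1 + 2x) ≥ 1`, which holds on `[0, 1/2]`. -/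
lemma exp_neg_le_one_sub_pow (x : ℝ) (hx : 0 ≤ x) (hx' : x ≤ 1 / 2) (j : ℕ) :
    Real.exp (-(2 * x * j)) ≤ (1 - x) ^ j := by
  rw [show -(2 * x * j) = (j : ℝ) * (-(2 * x)) by ring, Real.exp_nat_mul]
  gcongr
  rw [Real.exp_neg]
  have h := Real.add_one_le_exp (2 * x)
  rw [inv_le_comm₀ (Real.exp_pos _) (by linarith)]
  refine le_trans ?_ h
  rw [inv_le_iff_one_le_mul₀ (by linarith)]
  nlinarith

lemma choose_div_two_pow_le (N r : ℕ) (hN : 0 < N) :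
    (N.choose r : ℝ) / 2 ^ N ≤ 1 / Real.sqrt N := by
  have hN' : (0 : ℝ) < N := by exact_mod_cast hN
  obtain ⟨q, rfl | rfl⟩ := Nat.even_or_odd' N
  · have h1 : (2 * q).choose r ≤ q.centralBinom := Nat.choose_le_centralBinom r q
    have h2 := centralBinom_div_le q
    calc ((2 * q).choose r : ℝ) / 2 ^ (2 * q) ≤ (q.centralBinom : ℝ) / 4 ^ q := by
          rw [pow_mul]; norm_num; gcongr
      _ ≤ _ := h2
      _ ≤ _ := by
          apply one_div_le_one_div_of_le (Real.sqrt_pos.2 hN')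
          apply Real.sqrt_le_sqrt
          push_cast; linarith
  · have h1 : 2 * (2 * q + 1).choose r ≤ (q + 1).centralBinom := by
      have := Nat.choose_le_middle r (2 * q + 1)
      rw [show (2 * q + 1) / 2 = q by omega] at this
      have h3 : (2 * q + 1).choose (q + 1) = (2 * q + 1).choose q :=
        Nat.choose_symm_of_eq_add (by omega)
      have h4 := Nat.choose_succ_succ (2 * q + 1) q
      rw [Nat.centralBinom_eq_two_mul_choose, show 2 * (q + 1) = (2 * q + 1) + 1 by ring,
        Nat.choose_succ_succ, Nat.succ_eq_add_one, h3]
      omega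
    have h1' : 2 * ((2 * q + 1).choose r : ℝ) ≤ (q + 1).centralBinom := by exact_mod_cast h1
    have h2 := centralBinom_div_le (q + 1)
    calc ((2 * q + 1).choose r : ℝ) / 2 ^ (2 * q + 1)
        = 2 * ((2 * q + 1).choose r : ℝ) / 4 ^ (q + 1) := by
          rw [show (4 : ℝ) = 2 ^ 2 by norm_num, ← pow_mul,
            show 2 * (q + 1) = (2 * q + 1) + 1 by ring, pow_succ (2 : ℝ) (2 * q + 1)]
          field_simp
      _ ≤ ((q + 1).centralBinom : ℝ) / 4 ^ (q + 1) := by gcongr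
      _ ≤ _ := h2
      _ ≤ _ := by
          apply one_div_le_one_div_of_le (Real.sqrt_pos.2 hN')
          apply Real.sqrt_le_sqrt
          push_cast; linarith

lemma passageProb_eq (n q : ℕ) (h : 0 < n + 2 * q) :
    passageProb n (n + q)
      = n / (n + 2 * q : ℕ) * ((n + 2 * q).choose q / 2 ^ (n + 2 * q)) := by
  have := passageProb_add n q
  have h' : (0 : ℝ) < ((n + 2 * q : ℕ) : ℝ) := by exact_mod_cast h
  rw [div_mul_div_comm, eq_div_iff (by positivity), ← this]
  push_cast
  ring

/-- Local upper bound at the scale `s ≍ m ^ 2`. -/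
lemma passageProb_le (α : ℝ) (hα : 0 < α) (m n s : ℕ) (hm : 0 < m) (hn : n ≤ 2 * m) (hns : n ≤ s)
    (hs : α * m ^ 2 ≤ s) :
    passageProb n s ≤ 2 / (α * Real.sqrt α) / m ^ 2 := by
  obtain ⟨q, rfl⟩ := Nat.exists_eq_add_of_le hns
  have hm' : (0 : ℝ) < m := by exact_mod_cast hm
  have hN : (α * m ^ 2 : ℝ) ≤ (n + 2 * q : ℕ) := by
    refine hs.trans ?_
    push_cast
    have : (0 : ℝ) ≤ q := by positivity
    linarith
  have hN0 : (0 : ℝ) < (n + 2 * q : ℕ) := lt_of_lt_of_le (by positivity) hN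
  have hN0' : 0 < n + 2 * q := by exact_mod_cast hN0
  have hn' : (n : ℝ) ≤ 2 * m := by exact_mod_cast hn
  have h1 : Real.sqrt α * m ≤ Real.sqrt (n + 2 * q : ℕ) := by
    apply Real.le_sqrt_of_sq_le
    rw [mul_pow, Real.sq_sqrt hα.le]
    exact hN
  rw [passageProb_eq n q hN0']
  have hsα := Real.sqrt_pos.2 hα
  have hch := choose_div_two_pow_le _ q hN0'
  calc (n : ℝ) / (n + 2 * q : ℕ) * ((n + 2 * q).choose q / 2 ^ (n + 2 * q))
      ≤ 2 * m / (α * m ^ 2) * (1 / Real.sqrt (n + 2 * q : ℕ)) := by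
        refine mul_le_mul ?_ hch (by positivity) (by positivity)
        gcongr
    _ ≤ 2 * m / (α * m ^ 2) * (1 / (Real.sqrt α * m)) := by gcongr
    _ = _ := by field_simp

/-- Local lower bound at the scale `n ≍ m`, `s ≍ m ^ 2`. -/
lemma exists_le_passageProb (α β : ℝ) (hα : 0 < α) (hβ : 0 < β) :
    ∃ c : ℝ, 0 < c ∧ ∃ M : ℝ, ∀ m n s : ℕ, 0 < m → M ≤ m → m ≤ 2 * n → n ≤ m + 1 →
      α * m ^ 2 ≤ s → s ≤ β * m ^ 2 → c / m ^ 2 ≤ passageProb n s := by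
  -- The first factor bounds `n / N`, the square root comes from `4p + 1 ≤ 5 β m ^ 2`, and the
  -- exponential is the loss off the centre. The threshold `16 / α` gives `16 m ≤ s`, hence `2 * j ≤
  -- p`.
  refine ⟨1 / (4 * β) * (Real.exp (-(16 / α)) / (2 * Real.sqrt (5 * β))), by positivity,
    max 2 (16 / α), ?_⟩
  intro m n s hm hM hmn hnm hs hs'
  have hm' : (0 : ℝ) < m := by exact_mod_cast hm
  have hM1 : (2 : ℝ) ≤ m := (le_max_left _ _).trans hM
  have hM2 : 16 ≤ α * m := by
    have := (le_max_right _ _).trans hM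
    rwa [div_le_iff₀ hα, mul_comm] at this
  have hs16 : (16 : ℝ) * m ≤ s := by nlinarith
  have hns : 16 * m ≤ s := by exact_mod_cast hs16
  have hm2 : 2 ≤ m := by exact_mod_cast hM1
  obtain ⟨q, rfl⟩ := Nat.exists_eq_add_of_le (show n ≤ s by omega)
  have hN0' : 0 < n + 2 * q := by omega
  set N := n + 2 * q with hN
  -- The even row `2 * p` replaces row `N` at the cost of a factor 2; there `q` is at distance `j =
  -- n / 2` from the centre.
  set p := N / 2 with hp
  set j := n / 2 with hj
  have hpq : q = p - j := by omega
  have hjm : j ≤ m := by omega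
  have hps : n + q ≤ 4 * p := by omega
  have hjp : 2 * j ≤ p := by omega
  have hp0 : 0 < p := by omega
  have hp0' : (0 : ℝ) < p := by exact_mod_cast hp0
  have hjm' : (j : ℝ) ≤ m := by exact_mod_cast hjm
  have hps' : ((n + q : ℕ) : ℝ) ≤ 4 * p := by exact_mod_cast hps
  have hx : 2 * (j : ℝ) / p ≤ 8 / (α * m) := by
    rw [div_le_div_iff₀ hp0' (by positivity)]
    have : α * m ^ 2 ≤ 4 * p := hs.trans hps'
    have h2 : (j : ℝ) * (α * m) ≤ m * (α * m) := by gcongr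
    nlinarith
  have hx2 : 2 * (j : ℝ) / p ≤ 1 / 2 := by
    refine hx.trans ?_
    rw [div_le_iff₀ (by positivity)]
    linarith
  have hx0 : 0 ≤ 2 * (j : ℝ) / p := by positivity
  have hexp : Real.exp (-(16 / α)) ≤ (1 - 2 * (j : ℝ) / p) ^ j := by
    refine le_trans ?_ (exp_neg_le_one_sub_pow _ hx0 hx2 j)
    rw [Real.exp_le_exp, neg_le_neg_iff]
    calc 2 * (2 * (j : ℝ) / p) * j ≤ 2 * (8 / (α * m)) * m := by gcongr
      _ = 16 / α := by field_simp; norm_num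
  have hch : Real.exp (-(16 / α)) / (2 * Real.sqrt (5 * β) * m) ≤ (N.choose q : ℝ) / 2 ^ N := by
    have h1 : Real.exp (-(16 / α)) * p.centralBinom ≤ (N.choose q : ℝ) := by
      calc Real.exp (-(16 / α)) * p.centralBinom
          ≤ (1 - 2 * (j : ℝ) / p) ^ j * p.centralBinom := by gcongr
        _ ≤ (2 * p).choose (p - j) := le_choose_central p j hp0 hjp j le_rfl
        _ ≤ (N.choose q : ℝ) := by
          rw [← hpq]
          exact_mod_cast Nat.choose_le_choose q (by omega : 2 * p ≤ N)
    have h2 : (2 : ℝ) ^ N ≤ 2 * 4 ^ p := by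
      rw [show (4 : ℝ) = 2 ^ 2 by norm_num, ← pow_mul, ← pow_succ']
      exact pow_le_pow_right₀ (by norm_num) (by omega)
    have h3 : Real.sqrt (4 * p + 1) ≤ Real.sqrt (5 * β) * m := by
      apply Real.sqrt_le_iff.2 ⟨by positivity, ?_⟩
      rw [mul_pow, Real.sq_sqrt (by positivity)]
      have : 4 * p + 1 ≤ 5 * (n + q) := by omega
      have : (4 * p + 1 : ℝ) ≤ 5 * (n + q : ℕ) := by exact_mod_cast this
      linarith
    have h4 := le_centralBinom_div p
    calc Real.exp (-(16 / α)) / (2 * Real.sqrt (5 * β) * m)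
        = Real.exp (-(16 / α)) * (1 / (Real.sqrt (5 * β) * m)) / 2 := by field_simp
      _ ≤ Real.exp (-(16 / α)) * (1 / Real.sqrt (4 * p + 1)) / 2 := by gcongr
      _ ≤ Real.exp (-(16 / α)) * ((p.centralBinom : ℝ) / 4 ^ p) / 2 := by gcongr
      _ = Real.exp (-(16 / α)) * p.centralBinom / (2 * 4 ^ p) := by field_simp
      _ ≤ (N.choose q : ℝ) / 2 ^ N := by gcongr
  have hfrac : 1 / (4 * β) / m ≤ (n : ℝ) / (N : ℕ) := by
    have h1 : (m : ℝ) ≤ 2 * n := by exact_mod_cast hmn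
    have h2 : N ≤ 2 * (n + q) := by omega
    have h2 : (N : ℝ) ≤ 2 * (n + q : ℕ) := by exact_mod_cast h2
    have h3 : (0 : ℝ) < N := by exact_mod_cast hN0'
    rw [div_div, div_le_div_iff₀ (by positivity) h3]
    have h4 : β * m * m ≤ β * m * (2 * n) := by gcongr
    nlinarith
  rw [passageProb_eq n q hN0']
  calc 1 / (4 * β) * (Real.exp (-(16 / α)) / (2 * Real.sqrt (5 * β))) / m ^ 2
      = (1 / (4 * β) / m) * (Real.exp (-(16 / α)) / (2 * Real.sqrt (5 * β) * m)) := by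
        field_simp
    _ ≤ _ := by gcongr

/-! ### Entropy from a family of symmetries. -/

/-- Entropy lower bound by averaging over a family of measure-preserving permutations. -/
lemma sum_mul_le_shannonEntropy {Ω α T : Type*} [Fintype α] [DecidableEq α] [Fintype T] [Nonempty T]
    (space : Finset Ω) (P : Ω → ℝ) (X : Ω → α) (act : T → Equiv.Perm Ω) (ν : Ω → ℕ)
    (hP : ∀ ω ∈ space, 0 ≤ P ω) (hsum : ∑ ω ∈ space, P ω = 1)
    (hmem : ∀ τ ω, ω ∈ space ↔ act τ ω ∈ space) (hinv : ∀ τ ω, P (act τ ω) = P ω)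
    (hν : ∀ ω ∈ space, ∀ x, (#{τ | X (act τ ω) = x} : ℝ) * 2 ^ ν ω ≤ Fintype.card T) :
    ∑ ω ∈ space, P ω * ν ω ≤ shannonEntropy space P X := by
  have hT : (0 : ℝ) < Fintype.card T := by exact_mod_cast Fintype.card_pos
  -- `q ω` is the law of `X (act τ ω)` for uniform `τ`; by invariance the law of `X` is the
  -- `P`-mixture of these.
  set q : Ω → α → ℝ := fun ω x => (#{τ | X (act τ ω) = x} : ℝ) / Fintype.card T with hq
  have hq0 : ∀ ω x, 0 ≤ q ω x := fun ω x => by positivity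
  have hq1 : ∀ ω, ∑ x, q ω x = 1 := by
    intro ω
    simp only [hq, ← sum_div]
    rw [div_eq_one_iff_eq hT.ne', ← Nat.cast_sum]
    congr 1
    have := card_eq_sum_card_fiberwise (f := fun τ => X (act τ ω)) (s := (univ : Finset T))
      (t := (univ : Finset α)) (fun _ _ => by simp)
    rw [← this, card_univ]
  have hp : ∀ x, ∑ ω ∈ space with X ω = x, P ω = ∑ ω ∈ space, P ω * q ω x := by
    intro x
    have h1 : ∀ τ, ∑ ω ∈ space with X ω = x, P ω
        = ∑ ω ∈ space, P ω * (if X (act τ ω) = x then 1 else 0) := by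
      intro τ
      rw [sum_filter]
      refine (sum_equiv (act τ) (hmem τ) fun ω _ => ?_).symm
      rw [hinv]
      split_ifs <;> simp
    have h2 : (Fintype.card T : ℝ) * ∑ ω ∈ space with X ω = x, P ω
        = ∑ ω ∈ space, P ω * #{τ | X (act τ ω) = x} := by
      calc (Fintype.card T : ℝ) * ∑ ω ∈ space with X ω = x, P ω
          = ∑ _τ : T, ∑ ω ∈ space with X ω = x, P ω := by simp
        _ = ∑ τ, ∑ ω ∈ space, P ω * (if X (act τ ω) = x then 1 else 0) :=
          sum_congr rfl fun τ _ => h1 τ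
        _ = _ := by
          rw [sum_comm]
          refine sum_congr rfl fun ω _ => ?_
          rw [← mul_sum, sum_boole]
    rw [← mul_right_inj' hT.ne', h2, mul_sum]
    refine sum_congr rfl fun ω _ => ?_
    simp only [hq]
    field_simp
  have hlog : (0 : ℝ) < Real.log 2 := Real.log_pos (by norm_num)
  -- Each atom of `q ω` is at most `2 ^ (-ν ω)`, so `q ω` has at least `ν ω` bits of entropy.
  have hpt : ∀ ω ∈ space, ∀ x, q ω x * (ν ω * Real.log 2) ≤ Real.negMulLog (q ω x) := by
    intro ω hω x
    rcases (hq0 ω x).eq_or_lt with h | h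
    · rw [← h]; simp
    · rw [Real.negMulLog, neg_mul, ← mul_neg]
      gcongr
      have h3 : q ω x * 2 ^ ν ω ≤ 1 := by
        simp only [hq]
        rw [div_mul_eq_mul_div, div_le_one hT]
        exact hν ω hω x
      have h4 := Real.log_le_log (by positivity) h3
      rw [Real.log_mul h.ne' (by positivity), Real.log_pow, Real.log_one] at h4
      linarith
  unfold shannonEntropy
  rw [← sum_div, le_div_iff₀ hlog]
  calc (∑ ω ∈ space, P ω * ν ω) * Real.log 2
      = ∑ ω ∈ space, P ω * (ν ω * Real.log 2) * ∑ x, q ω x := by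
        rw [sum_mul]; refine sum_congr rfl fun ω _ => ?_
        rw [hq1]; ring
    _ = ∑ x, ∑ ω ∈ space, P ω * (q ω x * (ν ω * Real.log 2)) := by
        simp only [mul_sum]; rw [sum_comm]
        refine sum_congr rfl fun x _ => sum_congr rfl fun ω _ => by ring
    _ ≤ ∑ x, ∑ ω ∈ space, P ω * Real.negMulLog (q ω x) := by
        refine sum_le_sum fun x _ => sum_le_sum fun ω hω => ?_
        exact mul_le_mul_of_nonneg_left (hpt ω hω x) (hP ω hω)
    _ ≤ ∑ x, Real.negMulLog (∑ ω ∈ space with X ω = x, P ω) := by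
        refine sum_le_sum fun x _ => ?_
        rw [hp x]
        -- Jensen: the entropy of the mixture is at least the mean entropy.
        exact Real.concaveOn_negMulLog.le_map_sum hP hsum fun ω _ => hq0 ω x

lemma card_bool_fun_mul_le {n : ℕ} (I : Finset (Fin n)) (β : Fin n → Bool) :
    #{τ : Fin n → Bool | ∀ i ∈ I, τ i = β i} * 2 ^ #I = Fintype.card (Fin n → Bool) := by
  have : ({τ : Fin n → Bool | ∀ i ∈ I, τ i = β i} : Finset _)
      = Fintype.piFinset fun i => if i ∈ I then {β i} else univ := by
    ext τ
    simp only [mem_filter, mem_univ, true_and, Fintype.mem_piFinset]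
    refine forall_congr' fun i => ?_
    split_ifs with h <;> simp [h]
  rw [this, Fintype.card_piFinset]
  have h2 : ∀ i, #(if i ∈ I then {β i} else (univ : Finset Bool)) = if i ∈ I then 1 else 2 := by
    intro i; split_ifs <;> simp
  simp only [h2, prod_ite, prod_const_one, prod_const, one_mul]
  rw [← pow_add, add_comm, show ({x | x ∉ I} : Finset (Fin n)) = Iᶜ by ext; simp, card_add_card_compl]
  simp

/-! ### From configurations to vectors of gaps. -/

/-- The weight of the gap vectors with prescribed sums over the fibres of `κ` factorizes. -/
lemma sum_prod_passage_fiberwise {ι K : Type*} [Fintype ι] [DecidableEq ι] [Fintype K]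
    [DecidableEq K] (κ : ι → K) (c : K → ℕ) :
    ∑ g ∈ (piAntidiag univ (∑ k, c k)).filter (fun g : ι → ℕ => ∀ k, ∑ i with κ i = k, g i = c k),
        ∏ i, PowerSeries.coeff (g i) passageSeries
      = ∏ k, passageProb #{i | κ i = k} (c k) := by
  have h1 : ∀ k, passageProb #{i | κ i = k} (c k)
      = ∑ l ∈ finsuppAntidiag ({i | κ i = k} : Finset ι) (c k),
          ∏ i with κ i = k, PowerSeries.coeff (l i) passageSeries := by
    intro k
    rw [passageProb, ← prod_const, PowerSeries.coeff_prod]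
  simp only [h1]
  rw [prod_univ_sum]
  symm
  refine sum_bij (fun p _ i => p (κ i) i) ?_ ?_ ?_ ?_
  · intro p hp
    simp only [Fintype.mem_piFinset, mem_finsuppAntidiag] at hp
    have hk : ∀ k, ∑ i with κ i = k, p (κ i) i = c k := by
      intro k
      rw [← (hp k).1]
      exact sum_congr rfl fun i hi => by rw [(mem_filter.1 hi).2]
    simp only [mem_filter, mem_piAntidiag, mem_univ, implies_true, and_true]
    refine ⟨?_, hk⟩
    rw [← sum_fiberwise univ κ]
    exact sum_congr rfl fun k _ => hk k
  · intro p hp p' hp' h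
    simp only [Fintype.mem_piFinset, mem_finsuppAntidiag] at hp hp'
    funext k
    ext i
    by_cases hi : κ i = k
    · subst hi; exact congrFun h i
    · have a1 : i ∉ (p k).support := fun hh => hi (mem_filter.1 ((hp k).2 hh)).2
      have a2 : i ∉ (p' k).support := fun hh => hi (mem_filter.1 ((hp' k).2 hh)).2
      rw [Finsupp.notMem_support_iff.1 a1, Finsupp.notMem_support_iff.1 a2]
  · intro g hg
    simp only [mem_filter, mem_piAntidiag, mem_univ, implies_true, and_true] at hg
    -- Extension by zero off the fibre meets the support condition of `finsuppAntidiag`.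
    refine ⟨fun k => Finsupp.equivFunOnFinite.symm fun i => if κ i = k then g i else 0, ?_, ?_⟩
    · simp only [Fintype.mem_piFinset, mem_finsuppAntidiag]
      intro k
      refine ⟨?_, ?_⟩
      · rw [← hg.2 k]
        exact sum_congr rfl fun i hi => by simp [(mem_filter.1 hi).2]
      · intro i hi
        simp at hi
        simp [hi.1]
    · funext i; simp
  · intro p hp
    rw [← prod_fiberwise univ κ]
    exact prod_congr rfl fun k _ => prod_congr rfl fun i hi => by
      simp only [(mem_filter.1 hi).2]

lemma sum_prod_passage {ι : Type*} [Fintype ι] [DecidableEq ι] (s : ℕ) :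
    ∑ g ∈ piAntidiag (univ : Finset ι) s, ∏ i, PowerSeries.coeff (g i) passageSeries
      = passageProb (Fintype.card ι) s := by
  have h := sum_prod_passage_fiberwise (fun _ : ι => ()) (fun _ => s)
  simp only [univ_unique, sum_singleton, prod_singleton, forall_const, filter_true] at h
  rw [← card_univ, ← h]
  refine sum_congr ?_ fun _ _ => rfl
  ext g
  simp

/-- The sum of the gaps with index below `e`. -/
def prefixSum {N : ℕ} (g : Fin N → ℕ) (e : ℕ) : ℕ := ∑ i with (i : Fin N).val < e, g i

lemma prefixSum_zero {N : ℕ} (g : Fin N → ℕ) : prefixSum g 0 = 0 := by simp [prefixSum]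

lemma prefixSum_mono {N : ℕ} (g : Fin N → ℕ) : Monotone (prefixSum g) := by
  intro a b hab
  refine sum_le_sum_of_subset fun i hi => ?_
  simp only [mem_filter, mem_univ, true_and] at hi ⊢
  omega

lemma prefixSum_of_le {N : ℕ} (g : Fin N → ℕ) {e : ℕ} (h : N ≤ e) :
    prefixSum g e = ∑ i, g i := by
  unfold prefixSum
  rw [filter_true_of_mem fun i _ => by omega]

lemma prefixSum_eq_add {N : ℕ} (g : Fin N → ℕ) {a b : ℕ} (h : a ≤ b) :
    prefixSum g b = prefixSum g a + ∑ i with a ≤ (i : Fin N).val ∧ i.val < b, g i := by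
  unfold prefixSum
  rw [← sum_union]
  · refine sum_congr ?_ fun _ _ => rfl
    ext i
    simp only [mem_filter, mem_univ, true_and, mem_union]
    omega
  · rw [disjoint_left]
    intro i
    simp only [mem_filter, mem_univ, true_and]
    omega

lemma prefixSum_succ {N : ℕ} (g : Fin N → ℕ) (e : Fin N) :
    prefixSum g (e.val + 1) = prefixSum g e.val + g e := by
  rw [prefixSum_eq_add g (Nat.le_succ e.val)]
  congr 1
  rw [show ({i | e.val ≤ (i : Fin N).val ∧ i.val < e.val + 1} : Finset (Fin N)) = {e} by
    ext i; simp only [mem_filter, mem_univ, true_and, mem_singleton, Fin.ext_iff]; omega]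
  simp

/-- The configuration with given gaps. -/
def gapPositions {m : ℕ} (g : Fin (m + 1) → ℕ) (j : Fin (m + 2)) : ℕ := prefixSum g j.val

lemma gapPositions_succ_sub {m : ℕ} (g : Fin (m + 1) → ℕ) (e : Fin (m + 1)) :
    gapPositions g e.succ - gapPositions g e.castSucc = g e := by
  simp [gapPositions, prefixSum_succ]

lemma sum_blockConfigs {U m : ℕ} (φ : (Fin (m + 2) → ℕ) → ℝ) :
    ∑ s ∈ blockConfigs U m, φ s
      = ∑ g ∈ piAntidiag univ (U + 1) with ∀ i : Fin (m + 1), 0 < g i, φ (gapPositions g) := by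
  have hinv : ∀ s ∈ blockConfigs U m,
      gapPositions (fun e : Fin (m + 1) => s e.succ - s e.castSucc) = s := by
    intro s hs
    simp only [blockConfigs, mem_filter] at hs
    funext j
    induction j using Fin.induction with
    | zero => simp [gapPositions, prefixSum_zero, hs.2.1]
    | succ j ih =>
      simp only [gapPositions, Fin.val_castSucc, Fin.val_succ] at ih ⊢
      rw [prefixSum_succ, ih]
      have := hs.2.2.2 j
      omega
  refine sum_nbij' (fun s e => s e.succ - s e.castSucc) gapPositions ?_ ?_ hinv ?_ ?_
  · intro s hs
    have h := congrFun (hinv s hs) (Fin.last (m + 1))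
    simp only [gapPositions, Fin.val_last, prefixSum_of_le _ le_rfl] at h
    simp only [blockConfigs, mem_filter] at hs
    simp only [mem_filter, mem_piAntidiag, mem_univ, implies_true, and_true]
    exact ⟨h.trans hs.2.2.1, fun i => Nat.sub_pos_of_lt (hs.2.2.2 i)⟩
  · intro g hg
    simp only [mem_filter, mem_piAntidiag, mem_univ, implies_true, and_true] at hg
    simp only [blockConfigs, mem_filter, Fintype.mem_piFinset, mem_range]
    refine ⟨fun j => ?_, by simp [gapPositions, prefixSum_zero], ?_, fun j => ?_⟩
    · have h := prefixSum_mono g (show j.val ≤ m + 1 by omega)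
      rw [prefixSum_of_le g le_rfl, hg.1] at h
      simp only [gapPositions]
      omega
    · simp [gapPositions, prefixSum_of_le g le_rfl, hg.1]
    · have := hg.2 j
      simp [gapPositions, prefixSum_succ, this]
  · intro g hg
    funext e
    exact gapPositions_succ_sub g e
  · intro s hs
    rw [hinv s hs]

/-- Tilting a gap `s` by `2 * 4 ^ (-s)` multiplies the product by a factor depending only on the
number of gaps and their total, both fixed here. -/
lemma catalanWeight_gapPositions {U m : ℕ} (g : Fin (m + 1) → ℕ) (hg : ∑ i, g i = U + 1)
    (hpos : ∀ i, 0 < g i) :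
    (catalanWeight (gapPositions g) : ℝ)
      = 4 ^ (U + 1) / 2 ^ (m + 1) * ∏ i, PowerSeries.coeff (g i) passageSeries := by
  have h : ∀ i, PowerSeries.coeff (g i) passageSeries
      = 2 * ((1 / 4) ^ g i * (catalan (g i - 1) : ℝ)) := by
    intro i
    obtain ⟨n, hn⟩ := Nat.exists_eq_add_of_le' (hpos i)
    rw [hn, coeff_passageSeries_succ, one_div, inv_pow, Nat.add_sub_cancel]
    ring
  unfold catalanWeight
  simp only [gapPositions_succ_sub, h, prod_mul_distrib, prod_const, card_univ, Fintype.card_fin,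
    prod_pow_eq_pow_sum, hg]
  push_cast
  rw [← mul_assoc, ← mul_assoc, one_div, inv_pow, div_mul_cancel₀ _ (by positivity),
    mul_inv_cancel₀ (by positivity), one_mul]

/-- Averages over configurations as averages over vectors of gaps. -/
lemma sum_catalanWeight_mul {U m : ℕ} (φ : (Fin (m + 2) → ℕ) → ℝ) :
    ∑ s ∈ blockConfigs U m, (catalanWeight s : ℝ) * φ s
      = 4 ^ (U + 1) / 2 ^ (m + 1) * ∑ g ∈ piAntidiag (univ : Finset (Fin (m + 1))) (U + 1),
          (∏ i, PowerSeries.coeff (g i) passageSeries) * φ (gapPositions g) := by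
  rw [sum_blockConfigs, mul_sum, sum_filter]
  refine sum_congr rfl fun g hg => ?_
  simp only [mem_piAntidiag, mem_univ, implies_true, and_true] at hg
  split_ifs with h
  · rw [catalanWeight_gapPositions g hg h]
    ring
  -- The gap law gives zero no mass, so vectors with a zero gap may be included.
  · push Not at h
    obtain ⟨i, hi⟩ := h
    rw [prod_eq_zero (mem_univ i)]
    · simp
    · rw [Nat.le_zero.1 hi, coeff_passageSeries_zero]

/-! ### Block swaps. -/

/-- Exchange the two halves of the `i`-th block of length `2 * t` whenever `β i`. -/
def swapHalves (t : ℕ) (β : ℕ → Bool) (e : ℕ) : ℕ :=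
  if β (e / (2 * t)) then (if e % (2 * t) < t then e + t else e - t) else e

lemma swapHalves_of_lower {t i r : ℕ} {β : ℕ → Bool} (hr : r < t) :
    swapHalves t β (2 * t * i + r) = if β i then 2 * t * i + t + r else 2 * t * i + r := by
  have h1 : (2 * t * i + r) / (2 * t) = i := by
    rw [Nat.mul_add_div (by omega), Nat.div_eq_of_lt (by omega), add_zero]
  have h2 : (2 * t * i + r) % (2 * t) = r := by
    rw [Nat.mul_add_mod, Nat.mod_eq_of_lt (by omega)]
  rw [swapHalves, h1, h2, if_pos hr]
  split_ifs <;> omega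

lemma swapHalves_of_upper {t i r : ℕ} {β : ℕ → Bool} (hr : r < t) :
    swapHalves t β (2 * t * i + t + r) = if β i then 2 * t * i + r else 2 * t * i + t + r := by
  have h1 : (2 * t * i + t + r) / (2 * t) = i := by
    rw [add_assoc, Nat.mul_add_div (by omega), Nat.div_eq_of_lt (by omega), add_zero]
  have h2 : (2 * t * i + t + r) % (2 * t) = t + r := by
    rw [add_assoc, Nat.mul_add_mod, Nat.mod_eq_of_lt (by omega)]
  rw [swapHalves, h1, h2, if_neg (show ¬t + r < t by omega)]
  split_ifs <;> omega

lemma exists_halves {t : ℕ} (ht : 0 < t) (e : ℕ) :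
    ∃ i r, r < t ∧ (e = 2 * t * i + r ∨ e = 2 * t * i + t + r) := by
  have h := Nat.div_add_mod e (2 * t)
  have h' := Nat.mod_lt e (show 0 < 2 * t by omega)
  rcases Nat.lt_or_ge (e % (2 * t)) t with h2 | h2
  · exact ⟨e / (2 * t), e % (2 * t), h2, Or.inl h.symm⟩
  · exact ⟨e / (2 * t), e % (2 * t) - t, by omega, Or.inr (by omega)⟩

lemma swapHalves_involutive {t : ℕ} (ht : 0 < t) (β : ℕ → Bool) :
    Function.Involutive (swapHalves t β) := by
  intro e
  obtain ⟨i, r, hr, rfl | rfl⟩ := exists_halves ht e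
  · rw [swapHalves_of_lower hr]
    split_ifs with h
    · rw [swapHalves_of_upper hr, if_pos h]
    · rw [swapHalves_of_lower hr, if_neg h]
  · rw [swapHalves_of_upper hr]
    split_ifs with h
    · rw [swapHalves_of_lower hr, if_pos h]
    · rw [swapHalves_of_upper hr, if_neg h]

lemma swapHalves_lt_iff {t : ℕ} (ht : 0 < t) (β : ℕ → Bool) (e i : ℕ) :
    swapHalves t β e < 2 * t * i ↔ e < 2 * t * i := by
  have key : ∀ e, e < 2 * t * i → swapHalves t β e < 2 * t * i := by
    intro e he
    obtain ⟨i', r, hr, hh⟩ := exists_halves ht e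
    have h1 : i' < i := by
      by_contra h
      have := Nat.mul_le_mul_left (2 * t) (not_lt.1 h)
      omega
    have h2 := Nat.mul_le_mul_left (2 * t) (Nat.succ_le_of_lt h1)
    rw [Nat.succ_eq_add_one, mul_add, mul_one] at h2
    rcases hh with rfl | rfl
    · rw [swapHalves_of_lower hr]; split_ifs <;> omega
    · rw [swapHalves_of_upper hr]; split_ifs <;> omega
  refine ⟨fun h => ?_, key e⟩
  have := key _ h
  rwa [swapHalves_involutive ht] at this

lemma swapHalves_lt {t n N : ℕ} (ht : 0 < t) (hN : 2 * t * n ≤ N) (β : ℕ → Bool)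
    (hβ : ∀ i, n ≤ i → β i = false) {e : ℕ} (he : e < N) : swapHalves t β e < N := by
  rcases Nat.lt_or_ge e (2 * t * n) with h | h
  · exact lt_of_lt_of_le ((swapHalves_lt_iff ht β e n).2 h) hN
  · have : n ≤ e / (2 * t) := by
      rw [Nat.le_div_iff_mul_le (by omega), mul_comm]
      exact h
    rw [swapHalves, hβ _ this]
    simpa using he

/-- Extension of a choice vector by `false`. -/
def extendChoice {n : ℕ} (τ : Fin n → Bool) (i : ℕ) : Bool := if h : i < n then τ ⟨i, h⟩ else false

/-- The permutation of the indices that exchanges the two halves of the blocks chosen by `τ`. -/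
def swapPerm {t n N : ℕ} (ht : 0 < t) (hN : 2 * t * n ≤ N) (τ : Fin n → Bool) :
    Equiv.Perm (Fin N) :=
  Function.Involutive.toPerm
    (fun e => ⟨swapHalves t (extendChoice τ) e,
      swapHalves_lt ht hN _ (fun i hi => by simp [extendChoice, not_lt.2 hi]) e.2⟩)
    fun e => Fin.ext (swapHalves_involutive ht _ e)

lemma val_swapPerm {t n N : ℕ} (ht : 0 < t) (hN : 2 * t * n ≤ N) (τ : Fin n → Bool) (e : Fin N) :
    (swapPerm ht hN τ e : ℕ) = swapHalves t (extendChoice τ) e := rfl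

/-- Swaps act within blocks, so the starting position of a block does not depend on any of the
choices; each bit can be read independently of the others. -/
lemma prefixSum_comp_swapPerm {t n N : ℕ} (ht : 0 < t) (hN : 2 * t * n ≤ N) (τ : Fin n → Bool)
    (g : Fin N → ℕ) (i : ℕ) :
    prefixSum (g ∘ swapPerm ht hN τ) (2 * t * i) = prefixSum g (2 * t * i) := by
  unfold prefixSum
  refine sum_equiv (swapPerm ht hN τ) (fun e => ?_) fun e _ => rfl
  simp only [mem_filter, mem_univ, true_and]
  rw [val_swapPerm, swapHalves_lt_iff ht]

/-! ### Good blocks and the windows that detect a swap. -/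

/-- The parts of a block of length `2 * t` starting at `e₀`, with `u`-th and `(t + v)`-th index
singled out: `u`, the rest of the first half, `t + v`, the rest of the second half, and all indices
outside of the block. -/
def blockPart (t e₀ u v e : ℕ) : Fin 5 :=
  if e < e₀ ∨ e₀ + 2 * t ≤ e then 4 else if e = e₀ + u then 0 else if e < e₀ + t then 1
  else if e = e₀ + t + v then 2 else 3

/-- The sum of the gaps in a part of a block. -/
def partSum {N : ℕ} (t e₀ u v : ℕ) (g : Fin N → ℕ) (k : Fin 5) : ℕ :=
  ∑ e with blockPart t e₀ u v (e : Fin N).val = k, g e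

/-- The first half of the block at `e₀` makes a single long jump, over a whole
interval of length `L`, and the second half makes a single jump, of length about `2 * L`. -/
def GoodBlock {N : ℕ} (t L e₀ : ℕ) (g : Fin N → ℕ) : Prop :=
  ∃ u < t, ∃ v < t, (3 * L ≤ partSum t e₀ u v g 0 ∧ partSum t e₀ u v g 0 ≤ 3 * L + L / 4) ∧
    partSum t e₀ u v g 1 ≤ L / 4 ∧
    (2 * L ≤ partSum t e₀ u v g 2 ∧ partSum t e₀ u v g 2 ≤ 2 * L + L / 4) ∧
    partSum t e₀ u v g 3 ≤ L / 4

lemma partSum_zero {N : ℕ} {t e₀ u v : ℕ} (hu : u < t) (g : Fin N → ℕ) (h : e₀ + u < N) :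
    partSum t e₀ u v g 0 = g ⟨e₀ + u, h⟩ := by
  unfold partSum
  rw [show ({e | blockPart t e₀ u v (e : Fin N).val = 0} : Finset (Fin N)) = {⟨e₀ + u, h⟩} by
    ext e
    simp only [mem_filter, mem_univ, true_and, mem_singleton, Fin.ext_iff, blockPart]
    split_ifs <;> simp <;> omega]
  simp

lemma partSum_two {N : ℕ} {t e₀ u v : ℕ} (hu : u < t) (hv : v < t) (g : Fin N → ℕ)
    (h : e₀ + t + v < N) :
    partSum t e₀ u v g 2 = g ⟨e₀ + t + v, h⟩ := by
  unfold partSum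
  rw [show ({e | blockPart t e₀ u v (e : Fin N).val = 2} : Finset (Fin N)) = {⟨e₀ + t + v, h⟩} by
    ext e
    simp only [mem_filter, mem_univ, true_and, mem_singleton, Fin.ext_iff, blockPart]
    split_ifs <;> simp <;> omega]
  simp

lemma sum_comp_le_partSum {N : ℕ} (σ : Equiv.Perm (Fin N)) (g : Fin N → ℕ) (t e₀ u v a b : ℕ)
    (k : Fin 5)
    (h : ∀ e : Fin N, a ≤ e.val → e.val < b → blockPart t e₀ u v (σ e).val = k) :
    ∑ e with a ≤ (e : Fin N).val ∧ e.val < b, (g ∘ σ) e ≤ partSum t e₀ u v g k := by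
  have : ∑ e with a ≤ (e : Fin N).val ∧ e.val < b, (g ∘ σ) e
      = ∑ e ∈ ({e | a ≤ (e : Fin N).val ∧ e.val < b} : Finset (Fin N)).map σ.toEmbedding, g e := by
    rw [sum_map]; rfl
  rw [this]
  refine sum_le_sum_of_subset fun e he => ?_
  rw [mem_map] at he
  obtain ⟨e', he', rfl⟩ := he
  simp only [mem_filter, mem_univ, true_and] at he' ⊢
  exact h e' he'.1 he'.2

/-- The shift `Δ` places a window start in the upper half of `(x + L, x + 2 L]`. -/
def IsWindowIndex (L Δ x j : ℕ) : Prop := 2 * x + 3 * L < 2 * (Δ + j * L) ∧ Δ + j * L ≤ x + 2 * L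

/-- The window reads off whether the block has been swapped. -/
lemma intervalNonempty_swapPerm {m t n L i Δ j : ℕ} (ht : 0 < t) (hN : 2 * t * n ≤ m + 1)
    (hi : i < n) (g : Fin (m + 1) → ℕ) (hg : GoodBlock t L (2 * t * i) g)
    (hj : IsWindowIndex L Δ (prefixSum g (2 * t * i)) j) (τ : Fin n → Bool) :
    intervalNonempty L (gapPositions (g ∘ swapPerm ht hN τ), Δ) j = τ ⟨i, hi⟩ := by
  obtain ⟨u, hu, v, hv, ⟨h0, -⟩, h1, ⟨h2, h2'⟩, h3⟩ := hg
  obtain ⟨hj1, hj2⟩ := hj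
  set σ := swapPerm ht hN τ with hσ
  have hx := prefixSum_comp_swapPerm ht hN τ g i
  have hin : 2 * t * i + 2 * t ≤ m + 1 := by
    have := Nat.mul_le_mul_left (2 * t) (Nat.succ_le_of_lt hi)
    rw [Nat.succ_eq_add_one, mul_add, mul_one] at this
    omega
  have hext : extendChoice τ i = τ ⟨i, hi⟩ := by simp [extendChoice, hi]
  set e₀ := 2 * t * i with he₀
  set x := prefixSum g e₀ with hxdef
  rw [← hσ] at hx
  have hσl : ∀ e : Fin (m + 1), e₀ ≤ e.val → e.val < e₀ + t →
      (σ e).val = if τ ⟨i, hi⟩ then e.val + t else e.val := by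
    intro e h h'
    rw [hσ, val_swapPerm]
    obtain ⟨r, hr⟩ := Nat.exists_eq_add_of_le h
    rw [hr, he₀, swapHalves_of_lower (by omega), hext]
    split_ifs <;> omega
  rw [partSum_zero hu g (by omega)] at h0
  rw [partSum_two hu hv g (by omega)] at h2 h2'
  cases hτ : τ ⟨i, hi⟩ with
  | false =>
    -- Unswapped: the points stay at or below `x + L / 4` until the long jump takes them to at least
    -- `x + 3 * L`, and the window lies strictly between.
    simp only [hτ, Bool.false_eq_true, if_false] at hσl
    have hrest := sum_comp_le_partSum σ g t e₀ u v e₀ (e₀ + u) 1 (by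
      intro e h h'
      rw [hσl e h (by omega), blockPart]
      split_ifs <;> first | rfl | omega)
    have hlow := prefixSum_eq_add (g ∘ σ) (show e₀ ≤ e₀ + u by omega)
    have hhigh := prefixSum_succ (g ∘ σ) ⟨e₀ + u, by omega⟩
    have hjump : (g ∘ σ) ⟨e₀ + u, by omega⟩ = g ⟨e₀ + u, by omega⟩ := by
      simp only [Function.comp]
      congr 1
      apply Fin.ext
      rw [hσl _ (by simp) (by simpa using hu)]
    rw [hjump] at hhigh
    simp only at hhigh
    simp only [intervalNonempty, decide_eq_false_iff_not, not_exists, not_and, not_lt]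
    intro p hp
    simp only [gapPositions, Fin.val_succ, Fin.val_castSucc] at hp ⊢
    rw [add_mul, one_mul]
    rcases Nat.lt_or_ge (e₀ + u) (p.val + 1) with hpu | hpu
    · have := prefixSum_mono (g ∘ σ) (show e₀ + u + 1 ≤ p.val + 1 by omega)
      omega
    · have := prefixSum_mono (g ∘ σ) hpu
      omega
  | true =>
    -- Swapped: the jump of the former second half lands between `x + 2 * L` and `x + 2 * L + L /
    -- 2`. The window starts at or before `x + 2 * L` and ends after `x + 5L/2`.
    simp only [hτ, if_true] at hσl
    have hrest := sum_comp_le_partSum σ g t e₀ u v e₀ (e₀ + v) 3 (by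
      intro e h h'
      rw [hσl e h (by omega), blockPart]
      split_ifs <;> first | rfl | omega)
    have hlow := prefixSum_eq_add (g ∘ σ) (show e₀ ≤ e₀ + v by omega)
    have hhigh := prefixSum_succ (g ∘ σ) ⟨e₀ + v, by omega⟩
    have hjump : (g ∘ σ) ⟨e₀ + v, by omega⟩ = g ⟨e₀ + t + v, by omega⟩ := by
      simp only [Function.comp]
      congr 1
      apply Fin.ext
      rw [hσl _ (by simp) (by simpa using hv)]
      simp only
      omega
    rw [hjump] at hhigh
    simp only at hhigh
    simp only [intervalNonempty, decide_eq_true_eq]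
    refine ⟨⟨e₀ + v, by omega⟩, ?_⟩
    simp only [gapPositions, Fin.val_succ, Fin.val_castSucc]
    rw [add_mul, one_mul]
    omega

/-- The long jump fits before the end of the configuration; this keeps the detecting window among
the `K` observed ones. -/
lemma prefixSum_add_le_of_goodBlock {N t L e₀ : ℕ} {g : Fin N → ℕ} (hN : e₀ + 2 * t ≤ N)
    (hg : GoodBlock t L e₀ g) : prefixSum g e₀ + 3 * L ≤ ∑ e, g e := by
  obtain ⟨u, hu, v, hv, ⟨h0, -⟩, -⟩ := hg
  rw [partSum_zero hu g (by omega)] at h0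
  have h1 := prefixSum_succ g ⟨e₀ + u, by omega⟩
  have h2 := prefixSum_mono g (show e₀ ≤ e₀ + u by omega)
  have h3 := prefixSum_mono g (show e₀ + u + 1 ≤ N by omega)
  rw [prefixSum_of_le g le_rfl] at h3
  simp only at h1
  omega

open Classical in
/-- At least half of the shifts place a window start in the upper half of `(x + L, x + 2 L]`. -/
lemma le_card_isWindowIndex (L x : ℕ) (hL : 0 < L) :
    L ≤ 2 * #{Δ ∈ Icc 1 L | ∃ j, IsWindowIndex L Δ x j} := by
  have h : #(Ioc (x + L + L / 2) (x + 2 * L)) ≤ #{Δ ∈ Icc 1 L | ∃ j, IsWindowIndex L Δ x j} := by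
    -- `(y - 1) % L + 1` is the shift in `1, …, L` congruent to the window start `y`; it is
    -- injective on fewer than `L + 1` consecutive values.
    refine card_le_card_of_injOn (fun y => (y - 1) % L + 1) ?_ ?_
    · intro y hy
      simp only [coe_Ioc, Set.mem_Ioc] at hy
      have h1 := Nat.mod_lt (y - 1) hL
      have h2 := Nat.div_add_mod (y - 1) L
      simp only [coe_filter, Set.mem_ofPred_eq, mem_Icc]
      refine ⟨by omega, (y - 1) / L, ?_⟩
      unfold IsWindowIndex
      rw [mul_comm ((y - 1) / L) L]
      omega
    · intro y hy y' hy' h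
      simp only [coe_Ioc, Set.mem_Ioc] at hy hy'
      have h' : (y - 1) % L = (y' - 1) % L := by simpa using h
      have key : ∀ z z' : ℕ, z % L = z' % L → z ≤ z' → z' < z + L → z = z' := by
        intro z z' hz hle hlt
        have h3 := (Nat.modEq_iff_dvd' hle).1 hz
        have := Nat.eq_zero_of_dvd_of_lt h3 (by omega)
        omega
      rcases le_total y y' with hh | hh
      · have := key _ _ h' (by omega) (by omega)
        omega
      · have := key _ _ h'.symm (by omega) (by omega)
        omega
  rw [Nat.card_Ioc] at h
  omega

/-! ### The weight of the gap vectors with a good block. -/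

lemma card_filter_fin_val (N : ℕ) (p : ℕ → Prop) [DecidablePred p] :
    #{e : Fin N | p e.val} = #{e ∈ range N | p e} := by
  rw [card_filter, card_filter, Fin.sum_univ_eq_sum_range (fun e => if p e then 1 else 0)]

lemma card_blockPart {N t e₀ u v : ℕ} (hu : u < t) (hv : v < t) (hN : e₀ + 2 * t ≤ N) (k : Fin 5) :
    #{e : Fin N | blockPart t e₀ u v e.val = k} = ![1, t - 1, 1, t - 1, N - 2 * t] k := by
  rw [card_filter_fin_val N fun e => blockPart t e₀ u v e = k]
  match k with
  | 0 =>
    rw [show ({e ∈ range N | blockPart t e₀ u v e = 0} : Finset ℕ) = {e₀ + u} by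
      ext e; simp only [mem_filter, mem_range, mem_singleton]
      unfold blockPart
      split_ifs <;> simp <;> omega]
    simp
  | 1 =>
    rw [show ({e ∈ range N | blockPart t e₀ u v e = 1} : Finset ℕ)
        = (Ico e₀ (e₀ + t)).erase (e₀ + u) by
      ext e; simp only [mem_filter, mem_range, mem_erase, mem_Ico]
      unfold blockPart
      split_ifs <;> simp <;> omega]
    rw [card_erase_of_mem (by simp [hu])]
    simp
  | 2 =>
    rw [show ({e ∈ range N | blockPart t e₀ u v e = 2} : Finset ℕ) = {e₀ + t + v} by
      ext e; simp only [mem_filter, mem_range, mem_singleton]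
      unfold blockPart
      split_ifs <;> simp <;> omega]
    simp
  | 3 =>
    rw [show ({e ∈ range N | blockPart t e₀ u v e = 3} : Finset ℕ)
        = (Ico (e₀ + t) (e₀ + t + t)).erase (e₀ + t + v) by
      ext e; simp only [mem_filter, mem_range, mem_erase, mem_Ico]
      unfold blockPart
      split_ifs <;> simp <;> omega]
    rw [card_erase_of_mem (by simp [hv])]
    simp
  | 4 =>
    rw [show ({e ∈ range N | blockPart t e₀ u v e = 4} : Finset ℕ)
        = range N \ Ico e₀ (e₀ + 2 * t) by
      ext e; simp only [mem_filter, mem_range, mem_sdiff, mem_Ico]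
      unfold blockPart
      split_ifs <;> simp <;> omega]
    rw [card_sdiff_of_subset (fun e he => by
      simp only [mem_Ico, mem_range] at he ⊢; omega)]
    simp

/-- The sums of the parts of a block, in terms of the four inner ones and the total. -/
def partSums (s : ℕ) (c : ℕ × ℕ × ℕ × ℕ) : Fin 5 → ℕ :=
  ![c.1, c.2.1, c.2.2.1, c.2.2.2, s - (c.1 + c.2.1 + c.2.2.1 + c.2.2.2)]

/-- The admissible sums of the four inner parts of a good block. -/
def goodSums (L : ℕ) : Finset (ℕ × ℕ × ℕ × ℕ) :=
  Icc (3 * L) (3 * L + L / 4) ×ˢ range (L / 4 + 1) ×ˢ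
    Icc (2 * L) (2 * L + L / 4) ×ˢ range (L / 4 + 1)

/-- Gap vectors whose block at `e₀` has jumps at `u` and `t + v` and prescribed part sums. -/
def blockClass (N t e₀ s : ℕ) (q : (ℕ × ℕ) × (ℕ × ℕ × ℕ × ℕ)) : Finset (Fin N → ℕ) :=
  (piAntidiag univ s).filter fun g => ∀ k, partSum t e₀ q.1.1 q.1.2 g k = partSums s q.2 k

lemma mem_goodSums {L : ℕ} {c : ℕ × ℕ × ℕ × ℕ} : c ∈ goodSums L ↔
    (3 * L ≤ c.1 ∧ c.1 ≤ 3 * L + L / 4) ∧ c.2.1 < L / 4 + 1 ∧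
      (2 * L ≤ c.2.2.1 ∧ c.2.2.1 ≤ 2 * L + L / 4) ∧ c.2.2.2 < L / 4 + 1 := by
  simp only [goodSums, mem_product, mem_Icc, mem_range]

lemma sum_blockClass {N t e₀ s L : ℕ} (hN : e₀ + 2 * t ≤ N) (hs : 6 * L ≤ s)
    {q : (ℕ × ℕ) × (ℕ × ℕ × ℕ × ℕ)} (hu : q.1.1 < t) (hv : q.1.2 < t) (hc : q.2 ∈ goodSums L) :
    ∑ g ∈ blockClass N t e₀ s q, ∏ i, PowerSeries.coeff (g i) passageSeries
      = passageProb 1 q.2.1 * passageProb (t - 1) q.2.2.1 * passageProb 1 q.2.2.2.1 *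
        passageProb (t - 1) q.2.2.2.2 *
        passageProb (N - 2 * t) (s - (q.2.1 + q.2.2.1 + q.2.2.2.1 + q.2.2.2.2)) := by
  have h := sum_prod_passage_fiberwise (fun e : Fin N => blockPart t e₀ q.1.1 q.1.2 e.val)
    (partSums s q.2)
  rw [mem_goodSums] at hc
  -- The four inner sums total at most `6 * L ≤ s`, so the subtraction in `partSums` is not
  -- truncated.
  have hsum : ∑ k, partSums s q.2 k = s := by
    rw [Fin.sum_univ_five]
    simp only [partSums, Matrix.cons_val]
    omega
  rw [hsum] at h
  simp only [card_blockPart hu hv hN] at h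
  refine Eq.trans ?_ (h.trans ?_)
  · unfold blockClass partSum
    congr!
  · rw [Fin.prod_univ_five]
    simp [partSums]

lemma le_partSum_one {N t e₀ u u' v : ℕ} (hu : u < t) (hne : u ≠ u') (g : Fin N → ℕ)
    (h : e₀ + u < N) : g ⟨e₀ + u, h⟩ ≤ partSum t e₀ u' v g 1 := by
  unfold partSum
  refine single_le_sum (f := g) (fun _ _ => Nat.zero_le _) ?_
  simp only [mem_filter, mem_univ, true_and]
  unfold blockPart
  split_ifs <;> first | rfl | omega

lemma le_partSum_three {N t e₀ u v v' : ℕ} (hv : v < t) (hne : v ≠ v') (hu : u < t)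
    (g : Fin N → ℕ) (h : e₀ + t + v < N) : g ⟨e₀ + t + v, h⟩ ≤ partSum t e₀ u v' g 3 := by
  unfold partSum
  refine single_le_sum (f := g) (fun _ _ => Nat.zero_le _) ?_
  simp only [mem_filter, mem_univ, true_and]
  unfold blockPart
  split_ifs <;> first | rfl | omega

/-- The jump positions are determined by `g`: a second choice would put a jump of at least `2 * L`
into a part of sum at most `L / 4`. The part sums are then determined too. -/
lemma pairwiseDisjoint_blockClass {N t e₀ s L : ℕ} (hL : 0 < L) (hN : e₀ + 2 * t ≤ N) :
    Set.PairwiseDisjoint (((range t ×ˢ range t) ×ˢ goodSums L : Finset _) :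
      Set ((ℕ × ℕ) × (ℕ × ℕ × ℕ × ℕ))) (blockClass N t e₀ s) := by
  rintro ⟨⟨u, v⟩, c⟩ hq ⟨⟨u', v'⟩, c'⟩ hq' hne
  simp only [coe_product, Set.mem_prod, mem_coe, mem_range, mem_goodSums] at hq hq'
  rw [Function.onFun, disjoint_left]
  intro g hg hg'
  simp only [blockClass, mem_filter] at hg hg'
  apply hne
  have hg := hg.2
  have hg' := hg'.2
  obtain rfl : u = u' := by
    by_contra hne
    have h1 := le_partSum_one (e₀ := e₀) (v := v') hq.1.1 hne g (by omega)
    have h2 := partSum_zero (v := v) hq.1.1 g (by omega : e₀ + u < N)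
    have e1 := hg 0
    have e2 := hg' 1
    simp only [partSums, Matrix.cons_val] at e1 e2
    omega
  obtain rfl : v = v' := by
    by_contra hne
    have h1 := le_partSum_three (e₀ := e₀) (u := u) hq.1.2 hne hq.1.1 g (by omega)
    have h2 := partSum_two (u := u) hq.1.1 hq.1.2 g (by omega : e₀ + t + v < N)
    have e1 := hg 2
    have e2 := hg' 3
    simp only [partSums, Matrix.cons_val] at e1 e2
    omega
  have h : ∀ k, partSums s c k = partSums s c' k := fun k => (hg k).symm.trans (hg' k)
  have h0 := h 0
  have h1 := h 1
  have h2 := h 2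
  have h3 := h 3
  simp only [partSums, Matrix.cons_val] at h0 h1 h2 h3
  simp only [Prod.mk.injEq, true_and]
  exact Prod.ext h0 (Prod.ext h1 (Prod.ext h2 h3))

open Classical in
/-- Lower bound for the weight of the gap vectors with a good block, in terms of one- and
many-gap probabilities. -/
lemma le_sum_goodBlock_aux {N t e₀ s L : ℕ} (hL : 0 < L) (hN : e₀ + 2 * t ≤ N) (hs : 6 * L ≤ s)
    (κ : ℝ) (hκ : ∀ d ≤ 6 * L, κ ≤ passageProb (N - 2 * t) (s - d)) :
    (t : ℝ) ^ 2 * (∑ J ∈ Icc (3 * L) (3 * L + L / 4), passageProb 1 J) *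
        (∑ J ∈ Icc (2 * L) (2 * L + L / 4), passageProb 1 J) *
        (∑ r ∈ range (L / 4 + 1), passageProb (t - 1) r) ^ 2 * κ
      ≤ ∑ g ∈ piAntidiag (univ : Finset (Fin N)) s with GoodBlock t L e₀ g,
          ∏ i, PowerSeries.coeff (g i) passageSeries := by
  calc (t : ℝ) ^ 2 * (∑ J ∈ Icc (3 * L) (3 * L + L / 4), passageProb 1 J) *
        (∑ J ∈ Icc (2 * L) (2 * L + L / 4), passageProb 1 J) *
        (∑ r ∈ range (L / 4 + 1), passageProb (t - 1) r) ^ 2 * κ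
      = ∑ q ∈ (range t ×ˢ range t) ×ˢ goodSums L, passageProb 1 q.2.1 *
          passageProb (t - 1) q.2.2.1 * passageProb 1 q.2.2.2.1 *
          passageProb (t - 1) q.2.2.2.2 * κ := by
        unfold goodSums
        simp only [sum_product, ← mul_sum, ← sum_mul, sum_const, card_product,
          card_range, nsmul_eq_mul, Nat.cast_mul]
        ring
    _ ≤ ∑ q ∈ (range t ×ˢ range t) ×ˢ goodSums L,
          ∑ g ∈ blockClass N t e₀ s q, ∏ i, PowerSeries.coeff (g i) passageSeries := by
        refine sum_le_sum fun q hq => ?_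
        simp only [mem_product (s := range t ×ˢ range t), mem_product (s := range t),
          mem_range] at hq
        rw [sum_blockClass hN hs hq.1.1 hq.1.2 hq.2]
        have hc := mem_goodSums.1 hq.2
        have hp := passageProb_nonneg
        refine mul_le_mul_of_nonneg_left (hκ _ (by omega)) ?_
        exact mul_nonneg (mul_nonneg (mul_nonneg (hp _ _) (hp _ _)) (hp _ _)) (hp _ _)
    _ = ∑ g ∈ ((range t ×ˢ range t) ×ˢ goodSums L).biUnion (blockClass N t e₀ s),
          ∏ i, PowerSeries.coeff (g i) passageSeries :=
        (sum_biUnion (pairwiseDisjoint_blockClass hL hN)).symm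
    _ ≤ _ := by
        refine sum_le_sum_of_subset_of_nonneg (fun g hg => ?_) fun g _ _ =>
          prod_nonneg fun i _ => coeff_passageSeries_nonneg _
        rw [mem_biUnion] at hg
        obtain ⟨⟨⟨u, v⟩, c⟩, hq, hg⟩ := hg
        simp only [mem_product (s := range t ×ˢ range t), mem_product (s := range t),
          mem_range, mem_goodSums] at hq
        simp only [blockClass, mem_filter] at hg ⊢
        have h0 := hg.2 0
        have h1 := hg.2 1
        have h2 := hg.2 2
        have h3 := hg.2 3
        simp only [partSums, Matrix.cons_val] at h0 h1 h2 h3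
        refine ⟨hg.1, u, hq.1.1, v, hq.1.2, ?_⟩
        rw [h0, h1, h2, h3]
        omega

/-- The interval has at least `L / 4` values, each of mass at least of order `L ^ (-3/2)`. -/
lemma le_sum_passageProb_one_Icc {L A : ℕ} (hL : 0 < L) (hA : L ≤ A) (hA' : A + L / 4 ≤ 4 * L) :
    1 / (128 * Real.sqrt L) ≤ ∑ J ∈ Icc A (A + L / 4), passageProb 1 J := by
  have hL' : (0 : ℝ) < L := by exact_mod_cast hL
  have hs := Real.sqrt_pos.2 hL'
  have h : ∀ J ∈ Icc A (A + L / 4), 1 / (32 * L * Real.sqrt L) ≤ passageProb 1 J := by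
    intro J hJ
    rw [mem_Icc] at hJ
    have hJ0 : 1 ≤ J := by omega
    have hJ0' : (0 : ℝ) < J := by exact_mod_cast hJ0
    have hJ4 : (J : ℝ) ≤ 4 * L := by exact_mod_cast (by omega : J ≤ 4 * L)
    have hsJ : Real.sqrt J ≤ 2 * Real.sqrt L := by
      apply Real.sqrt_le_iff.2 ⟨by positivity, ?_⟩
      rw [mul_pow, Real.sq_sqrt hL'.le]
      linarith
    rw [passageProb_one]
    refine le_trans ?_ (le_coeff_passageSeries J hJ0)
    rw [div_div]
    have := Real.sqrt_pos.2 hJ0'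
    apply one_div_le_one_div_of_le (by positivity)
    calc (J : ℝ) * Real.sqrt J * 4 ≤ 4 * L * (2 * Real.sqrt L) * 4 := by gcongr
      _ = _ := by ring
  have h2 := card_nsmul_le_sum _ _ _ h
  refine le_trans ?_ h2
  rw [Nat.card_Icc, nsmul_eq_mul]
  have hcard : (L : ℝ) / 4 ≤ ((A + L / 4 + 1 - A : ℕ) : ℝ) := by
    rw [div_le_iff₀ (by norm_num)]
    exact_mod_cast (by omega : L ≤ (A + L / 4 + 1 - A) * 4)
  calc 1 / (128 * Real.sqrt L) = L / 4 * (1 / (32 * L * Real.sqrt L)) := by field_simp; norm_num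
    _ ≤ _ := by gcongr

/-- The number of gaps in half a block. -/
def halfBlock (L : ℕ) : ℕ := Nat.sqrt L / 4 + 1

/-- The size of `halfBlock` is chosen for this: about `√L / 4` gaps make the union bound of
`le_sum_passageProb` lose at most 1/2. -/
lemma half_le_sum_passageProb_halfBlock (L : ℕ) :
    1 / 2 ≤ ∑ r ∈ range (L / 4 + 1), passageProb (halfBlock L - 1) r := by
  refine le_trans ?_ (le_sum_passageProb _ _)
  have h0 : 0 < 2 * ((L / 4 : ℕ) : ℝ) + 1 := by positivity
  have hs := Real.sqrt_pos.2 h0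
  have h1 : 4 * (Nat.sqrt L / 4) ≤ Nat.sqrt L := Nat.mul_div_le _ _
  have h2 : Nat.sqrt L * Nat.sqrt L ≤ L := Nat.sqrt_le L
  have h3 : 4 * (Nat.sqrt L / 4) ^ 2 ≤ 2 * (L / 4) + 1 := by
    have : 16 * (Nat.sqrt L / 4) ^ 2 ≤ L := by
      have := Nat.mul_le_mul h1 h1
      nlinarith
    omega
  have h4 : ((Nat.sqrt L / 4 : ℕ) : ℝ) / Real.sqrt (2 * ((L / 4 : ℕ) : ℝ) + 1) ≤ 1 / 2 := by
    rw [div_le_iff₀ hs]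
    have : 2 * ((Nat.sqrt L / 4 : ℕ) : ℝ) ≤ Real.sqrt (2 * ((L / 4 : ℕ) : ℝ) + 1) := by
      apply Real.le_sqrt_of_sq_le
      rw [mul_pow]
      norm_num
      exact_mod_cast h3
    linarith
  rw [halfBlock, Nat.add_sub_cancel]
  linarith

lemma sqrt_le_halfBlock (L : ℕ) : Real.sqrt L ≤ 4 * halfBlock L := by
  apply Real.sqrt_le_iff.2 ⟨by positivity, ?_⟩
  have h1 : Nat.sqrt L + 1 ≤ 4 * halfBlock L := by unfold halfBlock; omega
  have h2 := Nat.lt_succ_sqrt L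
  have h3 : L ≤ (4 * halfBlock L) ^ 2 := by
    rw [Nat.succ_eq_add_one] at h2
    nlinarith
  exact_mod_cast h3

open Classical in
lemma le_sum_goodBlock {N e₀ s L : ℕ} (hL : 0 < L) (hN : e₀ + 2 * halfBlock L ≤ N)
    (hs : 6 * L ≤ s) (κ : ℝ) (hκ0 : 0 ≤ κ)
    (hκ : ∀ d ≤ 6 * L, κ ≤ passageProb (N - 2 * halfBlock L) (s - d)) :
    κ / 2 ^ 20 ≤ ∑ g ∈ piAntidiag (univ : Finset (Fin N)) s with GoodBlock (halfBlock L) L e₀ g,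
      ∏ i, PowerSeries.coeff (g i) passageSeries := by
  refine le_trans ?_ (le_sum_goodBlock_aux hL hN hs κ hκ)
  have hL' : (0 : ℝ) < L := by exact_mod_cast hL
  have hsL := Real.sqrt_pos.2 hL'
  have h1 := le_sum_passageProb_one_Icc (A := 3 * L) hL (by omega) (by omega)
  have h2 := le_sum_passageProb_one_Icc (A := 2 * L) hL (by omega) (by omega)
  have h3 := half_le_sum_passageProb_halfBlock L
  have h4 := sqrt_le_halfBlock L
  have h5 : Real.sqrt L / 4 ≤ halfBlock L := by linarith
  generalize ∑ J ∈ Icc (3 * L) (3 * L + L / 4), passageProb 1 J = A₁ at h1 ⊢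
  generalize ∑ J ∈ Icc (2 * L) (2 * L + L / 4), passageProb 1 J = A₂ at h2 ⊢
  have hA₁ : 0 ≤ A₁ := le_trans (by positivity) h1
  have hA₂ : 0 ≤ A₂ := le_trans (by positivity) h2
  -- The two choices of position cancel the two jump probabilities of order `L ^ (-1/2)`; the
  -- constants multiply to `2 ^ (-4 - 14 - 2)`.
  calc κ / 2 ^ 20 = (Real.sqrt L / 4) ^ 2 * (1 / (128 * Real.sqrt L)) * (1 / (128 * Real.sqrt L)) *
        (1 / 2) ^ 2 * κ := by field_simp; ring
    _ ≤ _ := by gcongr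

/-! ### Expected number of visible blocks as an entropy bound. -/

/-- The law of the gap vector together with the shift. -/
noncomputable def gapProb (U m L : ℕ) (ω : (Fin (m + 1) → ℕ) × ℕ) : ℝ :=
  (∏ i, PowerSeries.coeff (ω.1 i) passageSeries) / passageProb (m + 1) (U + 1) * (1 / (L : ℝ))

/-- The sample space of gap vectors and shifts. -/
def gapSpace (U m L : ℕ) : Finset ((Fin (m + 1) → ℕ) × ℕ) :=
  piAntidiag univ (U + 1) ×ˢ Icc 1 L

lemma catalanTotal_eq (U m : ℕ) :
    (catalanTotal U m : ℝ) = 4 ^ (U + 1) / 2 ^ (m + 1) * passageProb (m + 1) (U + 1) := by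
  have h := sum_catalanWeight_mul (U := U) (m := m) fun _ => 1
  simp only [mul_one, sum_prod_passage, Fintype.card_fin] at h
  rw [← h, catalanTotal]
  push_cast
  rfl

lemma indicatorEntropy_eq (U m L : ℕ) :
    indicatorEntropy U m L = shannonEntropy (gapSpace U m L) (gapProb U m L)
      (fun ω (j : ↥(Icc 1 (U / L))) => intervalNonempty L (gapPositions ω.1, ω.2) j) := by
  unfold indicatorEntropy shannonEntropy
  refine sum_congr rfl fun x _ => ?_
  congr 2
  rw [sum_filter, sum_filter, blockSpace, gapSpace, sum_product, sum_product]
  set c : ℝ := 4 ^ (U + 1) / 2 ^ (m + 1) with hc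
  have hc0 : c ≠ 0 := by positivity
  -- Summing over the shift first leaves a function of `s` alone, to which the passage to gaps
  -- applies.
  set φ : (Fin (m + 2) → ℕ) → ℝ := fun s => ∑ Δ ∈ Icc 1 L,
    if (fun j : ↥(Icc 1 (U / L)) => intervalNonempty L (s, Δ) j) = x then
      (1 / (catalanTotal U m : ℝ)) * (1 / (L : ℝ)) else 0 with hφ
  have h := sum_catalanWeight_mul (U := U) (m := m) φ
  refine Eq.trans ?_ (h.trans ?_)
  · refine sum_congr rfl fun s _ => ?_
    rw [hφ, mul_sum]
    refine sum_congr rfl fun Δ _ => ?_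
    rw [mul_ite, mul_zero]
    refine if_congr Iff.rfl ?_ rfl
    simp only [blockProb]
    ring
  · rw [mul_sum]
    refine sum_congr rfl fun g _ => ?_
    rw [hφ, mul_sum, mul_sum]
    refine sum_congr rfl fun Δ _ => ?_
    rw [mul_ite, mul_zero, mul_ite, mul_zero]
    refine if_congr Iff.rfl ?_ rfl
    simp only [gapProb]
    rw [catalanTotal_eq, ← hc, ← div_div, one_div c]
    field_simp

/-- Precomposition with a block swap, fixing the shift. -/
def swapAct {m t n : ℕ} (ht : 0 < t) (hN : 2 * t * n ≤ m + 1) (τ : Fin n → Bool) :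
    Equiv.Perm ((Fin (m + 1) → ℕ) × ℕ) :=
  Equiv.prodCongr ((swapPerm ht hN τ).symm.arrowCongr (Equiv.refl ℕ)) (Equiv.refl ℕ)

lemma swapAct_apply {m t n : ℕ} (ht : 0 < t) (hN : 2 * t * n ≤ m + 1) (τ : Fin n → Bool)
    (ω : (Fin (m + 1) → ℕ) × ℕ) : swapAct ht hN τ ω = (ω.1 ∘ swapPerm ht hN τ, ω.2) := by
  rfl

open Classical in
/-- The blocks whose swap is visible. -/
noncomputable def visibleBlocks {m : ℕ} (t n L : ℕ) (ω : (Fin (m + 1) → ℕ) × ℕ) : Finset (Fin n) :=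
  {i | GoodBlock t L (2 * t * i.val) ω.1 ∧
    ∃ j, IsWindowIndex L ω.2 (prefixSum ω.1 (2 * t * i.val)) j}

lemma block_end_le {t n N i : ℕ} (hN : 2 * t * n ≤ N) (hi : i < n) : 2 * t * i + 2 * t ≤ N := by
  have := Nat.mul_le_mul_left (2 * t) (Nat.succ_le_of_lt hi)
  rw [Nat.succ_eq_add_one, mul_add, mul_one] at this
  omega

lemma IsWindowIndex.mem_Icc {L Δ x j U : ℕ} (hL : 0 < L) (h : IsWindowIndex L Δ x j)
    (hΔ : Δ ≤ L) (hx : x + 3 * L ≤ U + 1) : j ∈ Icc 1 (U / L) := by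
  obtain ⟨h1, h2⟩ := h
  rw [Finset.mem_Icc, Nat.le_div_iff_mul_le hL]
  refine ⟨?_, by omega⟩
  by_contra hj
  obtain rfl : j = 0 := by omega
  omega

/-- The observed vector determines `τ` on all visible blocks, so each of its values is compatible
with at most a fraction `2 ^ (-ν)` of the choices. -/
lemma sum_mul_card_visibleBlocks_le {U m t n L : ℕ} (ht : 0 < t) (hN : 2 * t * n ≤ m + 1)
    (hL : 0 < L) (hZ : 0 < passageProb (m + 1) (U + 1)) :
    ∑ ω ∈ gapSpace U m L, gapProb U m L ω * #(visibleBlocks t n L ω)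
      ≤ indicatorEntropy U m L := by
  have hL' : (0 : ℝ) < L := by exact_mod_cast hL
  rw [indicatorEntropy_eq]
  refine sum_mul_le_shannonEntropy (gapSpace U m L) (gapProb U m L) _ (swapAct (n := n) ht hN)
    (fun ω => #(visibleBlocks t n L ω)) ?_ ?_ ?_ ?_ ?_
  · intro ω _
    refine mul_nonneg (div_nonneg (prod_nonneg fun i _ => coeff_passageSeries_nonneg _) hZ.le) ?_
    positivity
  · simp only [gapSpace, gapProb, sum_product, ← sum_mul, ← sum_div, sum_const, Nat.card_Icc]
    rw [← smul_sum, sum_prod_passage, Fintype.card_fin, nsmul_eq_mul, Nat.add_sub_cancel]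
    field_simp
  · intro τ ω
    rw [swapAct_apply]
    simp only [gapSpace, mem_product, mem_piAntidiag, mem_univ, implies_true, and_true,
      Function.comp]
    rw [Equiv.sum_comp (swapPerm ht hN τ) ω.1]
  · intro τ ω
    rw [swapAct_apply]
    simp only [gapProb, Function.comp]
    rw [Equiv.prod_comp (swapPerm ht hN τ) fun i => PowerSeries.coeff (ω.1 i) passageSeries]
  · rintro ⟨g, Δ⟩ hω x
    simp only [gapSpace, mem_product, mem_piAntidiag, mem_univ, implies_true, and_true] at hω
    have hΔ := (mem_Icc.1 hω.2).2
    have hj : ∀ i : Fin n, ∃ b : Bool, i ∈ visibleBlocks t n L (g, Δ) →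
        ∀ τ : Fin n → Bool, (fun j : ↥(Icc 1 (U / L)) => intervalNonempty L
          (gapPositions (swapAct ht hN τ (g, Δ)).1, (swapAct ht hN τ (g, Δ)).2) j) = x →
          τ i = b := by
      intro i
      by_cases hi : i ∈ visibleBlocks t n L (g, Δ)
      · simp only [visibleBlocks, mem_filter, mem_univ, true_and] at hi
        obtain ⟨hgood, j, hj⟩ := hi
        have hx := prefixSum_add_le_of_goodBlock (block_end_le hN i.2) hgood
        rw [hω.1] at hx
        refine ⟨x ⟨j, hj.mem_Icc hL hΔ hx⟩, fun _ τ hτ => ?_⟩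
        rw [← hτ]
        exact (intervalNonempty_swapPerm ht hN i.2 g hgood hj τ).symm
      · exact ⟨true, fun h => absurd h hi⟩
    choose β hβ using hj
    have h := card_bool_fun_mul_le (visibleBlocks t n L (g, Δ)) β
    have hle : #{τ | (fun j : ↥(Icc 1 (U / L)) => intervalNonempty L
          (gapPositions (swapAct ht hN τ (g, Δ)).1, (swapAct ht hN τ (g, Δ)).2) j) = x}
        ≤ #{τ : Fin n → Bool | ∀ i ∈ visibleBlocks t n L (g, Δ), τ i = β i} := by
      refine card_le_card fun τ hτ => ?_
      rw [mem_filter] at hτ ⊢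
      exact ⟨mem_univ _, fun i hi => hβ i hi τ hτ.2⟩
    exact_mod_cast (Nat.mul_le_mul_right _ hle).trans h.le

/-- Linearity of expectation over the blocks; the extra factor 2 beyond `2 ^ 20` pays for the
alignment of the shift. -/
lemma le_sum_mul_card_visibleBlocks {U m n L : ℕ} (hN : 2 * halfBlock L * n ≤ m + 1)
    (hL : 0 < L) (hZ : 0 < passageProb (m + 1) (U + 1)) (hs : 6 * L ≤ U + 1) (κ : ℝ) (hκ0 : 0 ≤ κ)
    (hκ : ∀ d ≤ 6 * L, κ ≤ passageProb (m + 1 - 2 * halfBlock L) (U + 1 - d)) :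
    n * (κ / 2 ^ 21 / passageProb (m + 1) (U + 1))
      ≤ ∑ ω ∈ gapSpace U m L, gapProb U m L ω * #(visibleBlocks (halfBlock L) n L ω) := by
  classical
  have hL' : (0 : ℝ) < L := by exact_mod_cast hL
  set t := halfBlock L with ht
  set Z := passageProb (m + 1) (U + 1) with hZdef
  have hblock : ∀ i : Fin n, κ / 2 ^ 21 / Z ≤ ∑ ω ∈ gapSpace U m L, gapProb U m L ω *
      (if GoodBlock t L (2 * t * i.val) ω.1 ∧
        ∃ j, IsWindowIndex L ω.2 (prefixSum ω.1 (2 * t * i.val)) j then 1 else 0) := by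
    intro i
    have h1 := le_sum_goodBlock hL (block_end_le hN i.2) hs κ hκ0 hκ
    calc κ / 2 ^ 21 / Z = κ / 2 ^ 20 * (1 / (2 * Z)) := by field_simp
      _ ≤ (∑ g ∈ piAntidiag (univ : Finset (Fin (m + 1))) (U + 1) with
            GoodBlock t L (2 * t * i.val) g,
          ∏ i, PowerSeries.coeff (g i) passageSeries) * (1 / (2 * Z)) := by
        gcongr
      _ = ∑ g ∈ piAntidiag (univ : Finset (Fin (m + 1))) (U + 1),
            if GoodBlock t L (2 * t * i.val) g then
              (∏ i, PowerSeries.coeff (g i) passageSeries) * (1 / (2 * Z)) else 0 := by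
        rw [sum_mul, sum_filter]
      _ ≤ ∑ g ∈ piAntidiag (univ : Finset (Fin (m + 1))) (U + 1), ∑ Δ ∈ Icc 1 L,
            gapProb U m L (g, Δ) * (if GoodBlock t L (2 * t * i.val) g ∧
              ∃ j, IsWindowIndex L Δ (prefixSum g (2 * t * i.val)) j then 1 else 0) := by
        refine sum_le_sum fun g _ => ?_
        simp only [gapProb]
        rw [← mul_sum]
        have hw : 0 ≤ ∏ i, PowerSeries.coeff (g i) passageSeries :=
          prod_nonneg fun i _ => coeff_passageSeries_nonneg _
        split_ifs with hg
        · simp only [hg, true_and, sum_boole]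
          have h2 := le_card_isWindowIndex L (prefixSum g (2 * t * i.val)) hL
          have h2' : (L : ℝ) ≤ 2 * (#{Δ ∈ Icc 1 L |
              ∃ j, IsWindowIndex L Δ (prefixSum g (2 * t * i.val)) j} : ℝ) := by
            exact_mod_cast h2
          calc (∏ i, PowerSeries.coeff (g i) passageSeries) * (1 / (2 * Z))
              = (∏ i, PowerSeries.coeff (g i) passageSeries) / Z * (1 / L) * (L / 2) := by
                field_simp
            _ ≤ _ := by
                refine mul_le_mul_of_nonneg_left (by linarith) ?_
                positivity
        · simp [hg]
      _ = _ := by rw [gapSpace, sum_product]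
  calc n * (κ / 2 ^ 21 / Z) = ∑ _i : Fin n, κ / 2 ^ 21 / Z := by simp
    _ ≤ ∑ i : Fin n, ∑ ω ∈ gapSpace U m L, gapProb U m L ω *
      (if GoodBlock t L (2 * t * i.val) ω.1 ∧
        ∃ j, IsWindowIndex L ω.2 (prefixSum ω.1 (2 * t * i.val)) j then 1 else 0) :=
      sum_le_sum fun i _ => hblock i
    _ = _ := by
      rw [sum_comm]
      refine sum_congr rfl fun ω _ => ?_
      rw [← mul_sum, sum_boole]
      congr!

/-! ### Choice of parameters and conclusion. -/

lemma eventually_le_sqrt_logFourth (M : ℝ) :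
    ∃ B₀ : ℕ, ∀ B : ℕ, B₀ ≤ B → M ≤ Real.sqrt (logFourth B) := by
  obtain ⟨r, hr⟩ := exists_nat_ge (max M 1)
  refine ⟨2 ^ r, fun B hB => ?_⟩
  have hr1 : (1 : ℝ) ≤ r := (le_max_right _ _).trans hr
  have hlog : (r : ℝ) ≤ Real.logb 2 B := by
    rw [Real.le_logb_iff_rpow_le (by norm_num)]
    · rw [Real.rpow_natCast]; exact_mod_cast hB
    · exact_mod_cast lt_of_lt_of_le (by positivity) hB
  have : logFourth B = (Real.logb 2 B ^ 2) ^ 2 := by unfold logFourth; ring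
  rw [this, Real.sqrt_sq (by positivity)]
  have := (le_max_left M 1).trans hr
  nlinarith

lemma halfBlock_mul_le (L : ℕ) : 4 * halfBlock L ≤ Nat.sqrt L + 4 := by
  unfold halfBlock
  omega

theorem mainTheorem2 (a b : ℝ) (ha : 0 < a) (hab : a ≤ b) :
    ∃ c : ℝ, 0 < c ∧ ∃ B₀ : ℕ, ∀ B : ℕ, B₀ ≤ B → ∀ m U : ℕ,
      1 ≤ intervalLength B m →
      a * (m : ℝ) ^ 2 ≤ (U : ℝ) → (U : ℝ) ≤ b * (m : ℝ) ^ 2 →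
      c * Real.sqrt (logFourth B) ≤ indicatorEntropy U m (intervalLength B m) := by
  have hb : 0 < b := ha.trans_le hab
  -- The slack in `a / 2` and `b + 1` covers all totals `U + 1 - d` with `d ≤ 6 * L ≤ a / 2 * m ^
  -- 2`.
  obtain ⟨c, hc, M, hlow⟩ := exists_le_passageProb (a / 2) (b + 1) (by positivity) (by positivity)
  set C : ℝ := 2 / (a * Real.sqrt a) with hCdef
  have hC : 0 < C := by positivity
  -- With `R = √k ≤ m`: `5` lets a removed block leave at least `m / 2` gaps and absorbs rounding in
  -- `n`, `M` is the threshold of the local bound, and `12 / a` gives `12 * m ≤ U` and `6 * L ≤ a /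
  -- 2 * m ^ 2`.
  obtain ⟨B₀, hB₀⟩ := eventually_le_sqrt_logFourth (max 5 (max M (12 / a)))
  refine ⟨c / (C * 2 ^ 21 * 5), by positivity, B₀, fun B hB m U hL hU hU' => ?_⟩
  have hR := hB₀ B hB
  set R := Real.sqrt (logFourth B) with hRdef
  set L := intervalLength B m with hLdef
  have hR5 : 5 ≤ R := (le_max_left _ _).trans hR
  have hRM : M ≤ R := ((le_max_left _ _).trans (le_max_right _ _)).trans hR
  have hRa : 12 ≤ a * R := by
    have := ((le_max_right _ _).trans (le_max_right _ _)).trans hR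
    rwa [div_le_iff₀ ha, mul_comm] at this
  have hkpos : 0 < logFourth B := Real.sqrt_pos.1 (by linarith)
  have hk : logFourth B = R ^ 2 := (Real.sq_sqrt hkpos.le).symm
  have hL0 : 0 < L := hL
  have hL1 : (1 : ℝ) ≤ L := by exact_mod_cast hL
  have hLk : (L : ℝ) * R ^ 2 ≤ m ^ 2 := by
    have := Nat.floor_le (show 0 ≤ (m : ℝ) ^ 2 / logFourth B by positivity)
    rw [hk, le_div_iff₀ (by positivity)] at this
    rw [hLdef, intervalLength, hk]
    exact this
  have hsL : Real.sqrt L * R ≤ m := by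
    refine (sq_le_sq₀ (by positivity) (by positivity)).1 ?_
    rw [mul_pow, Real.sq_sqrt (by positivity)]
    exact hLk
  have hRm : R ≤ m := by
    have : 1 ≤ Real.sqrt L := Real.one_le_sqrt.2 hL1
    nlinarith
  have hm0' : (0 : ℝ) < m := by linarith
  have hm0 : 0 < m := by exact_mod_cast hm0'
  have hm5 : 5 ≤ m := by exact_mod_cast hR5.trans hRm
  have ham : 12 * m ≤ a * (m : ℝ) ^ 2 := by
    have : a * R ≤ a * m := by gcongr
    nlinarith
  have hmU : 12 * m ≤ U := by exact_mod_cast ham.trans hU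
  have h6L : 6 * (L : ℝ) ≤ a / 2 * m ^ 2 := by
    have h1 : (12 : ℝ) * L ≤ a * R * L := by gcongr
    have h2 : a * R * L ≤ a * (L * R ^ 2) := by
      have : R ≤ R ^ 2 := by nlinarith
      calc a * R * L = a * (L * R) := by ring
        _ ≤ a * (L * R ^ 2) := by gcongr
    have h3 : a * (L * R ^ 2) ≤ a * m ^ 2 := by gcongr
    linarith
  have h6LU : 6 * L ≤ U + 1 := by
    have : 6 * (L : ℝ) ≤ U + 1 := by nlinarith
    exact_mod_cast this
  have hsq : (Nat.sqrt L : ℝ) ≤ Real.sqrt L := Real.nat_sqrt_le_real_sqrt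
  have hsq5 : 5 * Nat.sqrt L ≤ m := by
    have : 5 * (Nat.sqrt L : ℝ) ≤ m := by nlinarith [Real.sqrt_nonneg L]
    exact_mod_cast this
  have ht4 := halfBlock_mul_le L
  have ht0 : 0 < halfBlock L := Nat.succ_pos _
  have hU1 : ((U + 1 : ℕ) : ℝ) ≤ (b + 1) * m ^ 2 := by
    push_cast
    have : (1 : ℝ) ≤ m ^ 2 := by nlinarith
    linarith
  have hZlow : c / m ^ 2 ≤ passageProb (m + 1) (U + 1) := by
    refine hlow m (m + 1) (U + 1) hm0 (hRM.trans hRm) (by omega) le_rfl ?_ hU1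
    push_cast
    nlinarith
  have hZ : 0 < passageProb (m + 1) (U + 1) := lt_of_lt_of_le (by positivity) hZlow
  have hZup : passageProb (m + 1) (U + 1) ≤ C / m ^ 2 := by
    refine passageProb_le a ha m (m + 1) (U + 1) hm0 (by omega) (by omega) ?_
    push_cast
    linarith
  have hκ : ∀ d ≤ 6 * L, c / m ^ 2 ≤ passageProb (m + 1 - 2 * halfBlock L) (U + 1 - d) := by
    intro d hd
    have hd' : (d : ℝ) ≤ 6 * L := by exact_mod_cast hd
    have hcast : ((U + 1 - d : ℕ) : ℝ) = U + 1 - d := by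
      rw [Nat.cast_sub (by omega)]
      push_cast
      ring
    refine hlow m _ _ hm0 (hRM.trans hRm) (by omega) (by omega) ?_ ?_
    · rw [hcast]
      linarith
    · rw [hcast]
      push_cast at hU1
      have : (0 : ℝ) ≤ d := by positivity
      linarith
  set n := (m + 1) / (2 * halfBlock L) with hn
  have hN : 2 * halfBlock L * n ≤ m + 1 := Nat.mul_div_le _ _
  -- A block has at most `5/2 * √L` gaps and `√L * R ≤ m`, so `R < 5/2 * (n + 1)`; then `R ≥ 5`
  -- absorbs the `+ 1`.
  have hnR : R / 5 ≤ n := by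
    have h1 : m + 1 < 2 * halfBlock L * (n + 1) := by
      have := Nat.lt_mul_div_succ (m + 1) (show 0 < 2 * halfBlock L by omega)
      rwa [← hn] at this
    have h1' : (m : ℝ) + 1 < 2 * halfBlock L * (n + 1) := by exact_mod_cast h1
    have h2 : (4 * halfBlock L : ℝ) ≤ Nat.sqrt L + 4 := by exact_mod_cast ht4
    have h3 : 1 ≤ Real.sqrt L := Real.one_le_sqrt.2 hL1
    have h4 : (2 * halfBlock L : ℝ) ≤ 5 / 2 * Real.sqrt L := by linarith
    have h5 : Real.sqrt L * R < Real.sqrt L * (5 / 2 * (n + 1)) := by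
      calc Real.sqrt L * R ≤ m := hsL
        _ < 2 * halfBlock L * (n + 1) := by linarith
        _ ≤ 5 / 2 * Real.sqrt L * (n + 1) := by gcongr
        _ = _ := by ring
    have h6 := lt_of_mul_lt_mul_left h5 (Real.sqrt_nonneg _)
    linarith
  refine le_trans ?_ (sum_mul_card_visibleBlocks_le ht0 hN hL0 hZ)
  refine le_trans ?_ (le_sum_mul_card_visibleBlocks hN hL0 hZ h6LU (c / m ^ 2) (by positivity) hκ)
  calc c / (C * 2 ^ 21 * 5) * R = R / 5 * (c / m ^ 2 / 2 ^ 21 / (C / m ^ 2)) := by field_simp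
    _ ≤ _ := by gcongr
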